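/- **Setting.** Let $c>1$, $A=\frac{c-1}{24}$ and $T_{\rm gap}>0$. For every integer $J$ let $\rho_J(\Delta)\,d\Delta$ be a positive Borel measure on $\mathbb R$ (the spectral density of the spin-$J$ non-identity Virasoro primaries of a unitary two-dimensional CFT; it need not be discrete), supported in $\Delta-|J|>2T_{\rm gap}$ (twist gap), such that $\sum_J\int d\Delta\,\rho_J(\Delta)e^{-\beta\Delta-\mu J}$ converges absolutely whenever $\operatorname{Re}\beta>|\operatorname{Re}\mu|$. With $\rho(h,\bar h)=2\sum_J\rho_J(h+\bar h)\,\delta(J-\bar h+h)$ and $\eta(\beta)=e^{-\beta/24}\prod_{n\ge1}(1-e^{-n\beta})$, assume that the torus partition function $$Z(\beta_L,\beta_R)=\frac{e^{A(\beta_L+\beta_R)}}{\eta(\beta_L)\eta(\beta_R)}\Big[(1-e^{-\beta_L})(1-e^{-\beta_R})+\int_{T_{\rm gap}}^\infty\! dh\int_{T_{\rm gap}}^\infty\! d\bar h\,\rho(h,\bar h)e^{-h\beta_L-\bar h\beta_R}\Big],\qquad \operatorname{Re}\beta_L,\operatorname{Re}\beta_R>0,$$ is modular invariant: $Z(\beta_L,\beta_R)=Z(\beta_L+2\pi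 i,\beta_R-2\pi i)=Z\big(\tfrac{4\pi^2}{\beta_L},\tfrac{4\pi^2}{\beta_R}\big)$. **Vacuum density.** For $J\geq 1$ put $\alpha=2\pi\sqrt{A/J}$ and, for $\operatorname{Re}\beta_L>\alpha$, $$F_{\rm vac}(\beta_L,J)=\int_{\alpha-i\pi}^{\alpha+i\pi}\frac{dz}{2\pi i}\,e^{zJ}\sqrt{\frac{4\pi^2}{z(\beta_L-z)}}\;e^{\frac{4\pi^2A}{\beta_L-z}+\frac{4\pi^2A}{z}}\Big(1-e^{-\frac{4\pi^2}{\beta_L-z}}\Big)\Big(1-e^{-\frac{4\pi^2}{z}}\Big),$$ and define $\rho_{J,\rm vac}$ as its inverse Laplace transform, $$2\rho_{J,\rm vac}(J+2h)=\int_{\mathbb R}\frac{ds}{2\pi}\,F_{\rm vac}(\beta+is,J)\,e^{(\beta+is)(h-A)},$$ where $\beta>0$ is any fixed number (and $J$ is so large that $\beta>\alpha$). **Theorem.** Let $\varphi$ be a smooth function supported in $[-R,R]$, and set $\varphi_{h_*,\lambda}(h)=\frac1\lambda\varphi\big(\frac{h-h_*}{\lambda}\big)$. Let $\epsilon,\delta>0$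 be fixed and let $(\lambda_J)$ be a bounded sequence with $\lambda_J\ge\delta J^{-1/4+\epsilon}$ for all sufficiently large $J$. Then for every $p\in\mathbb N$ $$\int_{T_{\rm gap}}^\infty dh\,\varphi_{h_*,\lambda_J}(h)\big[\rho_J(J+2h)-\rho_{J,\rm vac}(J+2h)\big]=\frac{1}{\sqrt{2J}}\,e^{4\pi\sqrt{AJ}}\;o(J^{-p})\qquad(J\to\infty),$$ uniformly for $h_*$ in any bounded interval. For large $J$ all integrals involved converge absolutely. -/

import Mathlib

open MeasureTheory Filter Set
open scoped Real ContDiff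

noncomputable section

/-- The data of a two-dimensional CFT that enter its torus partition function: the central charge
`c`, half the twist gap `Tgap`, and for every integer spin `J` the spectral density
`ρ_J(Δ) dΔ` of the non-identity Virasoro primaries, a positive Borel measure in the scaling
dimension `Δ` (a sum of Dirac masses if the spectrum is discrete). -/
structure CFTData where
  /-- central charge -/
  c : ℝ
  /-- half of the twist gap -/
  Tgap : ℝ
  /-- `ρ_J(Δ) dΔ` -/
  rho : ℤ → Measure ℝ

/-- `A = (c - 1) / 24`. -/
def CFTData.A (S : CFTData) : ℝ := (S.c - 1) / 24

/-- The two-variable density `ρ(h, h̄) dh dh̄ = 2 ∑_J ρ_J(h + h̄) δ(J - h̄ + h) dh dh̄`, that is, the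
sum over `J` of the images of `ρ_J(Δ) dΔ` under `Δ ↦ (h, h̄) = ((Δ - J) / 2, (Δ + J) / 2)`. -/
def CFTData.pairDensity (S : CFTData) : Measure (ℝ × ℝ) :=
  Measure.sum fun J : ℤ => (S.rho J).map fun Δ : ℝ => ((Δ - J) / 2, (Δ + J) / 2)

/-- The Dedekind eta function in the variable `β`, `η(β) = e^{-β/24} ∏_{n ≥ 1} (1 - e^{-nβ})`
(Mathlib's eta function at `τ = iβ / (2π)`). -/
def etaBeta (β : ℂ) : ℂ := ModularForm.eta (Complex.I * β / (2 * π))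

/-- The torus partition function
`Z(β_L, β_R) = e^{A (β_L + β_R)} / (η(β_L) η(β_R)) *
  [(1 - e^{-β_L}) (1 - e^{-β_R}) + ∫∫_{h, h̄ > Tgap} ρ(h, h̄) e^{-h β_L - h̄ β_R} dh dh̄]`. -/
def CFTData.Z (S : CFTData) (βL βR : ℂ) : ℂ :=
  Complex.exp (S.A * (βL + βR)) / (etaBeta βL * etaBeta βR) *
    ((1 - Complex.exp (-βL)) * (1 - Complex.exp (-βR)) +
      ∫ x in Ioi S.Tgap ×ˢ Ioi S.Tgap,
        Complex.exp (-(x.1 : ℂ) * βL - (x.2 : ℂ) * βR) ∂S.pairDensity)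

/-- The standing assumptions: `c > 1`, a positive twist gap, convergence of the character sums, and
modular invariance of the torus partition function. -/
structure CFTData.IsModularCFT (S : CFTData) : Prop where
  one_lt_c : 1 < S.c
  Tgap_pos : 0 < S.Tgap
  /-- every `ρ_J` lives on `Δ - |J| > 2 Tgap` -/
  twist_gap : ∀ J : ℤ, S.rho J (Iic (|(J : ℝ)| + 2 * S.Tgap)) = 0
  /-- `∑_J ∫ ρ_J(Δ) e^{-βΔ - μJ} dΔ` converges absolutely for `Re β > |Re μ|` -/
  convergent : ∀ β μ : ℝ, |μ| < β →
    (∑' J : ℤ, ∫⁻ Δ, ENNReal.ofReal (Real.exp (-β * Δ - μ * J)) ∂S.rho J) ≠ ⊤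
  /-- invariance under the modular transformation `T` -/
  modular_T : ∀ βL βR : ℂ, 0 < βL.re → 0 < βR.re →
    S.Z (βL + 2 * π * Complex.I) (βR - 2 * π * Complex.I) = S.Z βL βR
  /-- invariance under the modular transformation `S` -/
  modular_S : ∀ βL βR : ℂ, 0 < βL.re → 0 < βR.re →
    S.Z (4 * π ^ 2 / βL) (4 * π ^ 2 / βR) = S.Z βL βR

/-- The measure `ρ_J(J + 2h) dh` on the `h`-line. Since `Δ = J + 2h` and `dh = dΔ / 2`, it is half
of the image of `ρ_J(Δ) dΔ` under `Δ ↦ h = (Δ - J) / 2`. -/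
def CFTData.rhoH (S : CFTData) (J : ℤ) : Measure ℝ :=
  (2⁻¹ : NNReal) • (S.rho J).map fun Δ : ℝ => (Δ - J) / 2

/-- `α = 2π √(A / J)`, the real part of the `z`-contour. -/
def alphaJ (A : ℝ) (J : ℤ) : ℝ := 2 * π * √(A / J)

/-- The integrand of the vacuum term as a function of `β_L` and `z`,
`√(4π² / (z (β_L - z))) e^{zJ + 4π²A/(β_L - z) + 4π²A/z} (1 - e^{-4π²/(β_L - z)}) (1 - e^{-4π²/z})`
(principal square root; `z` and `β_L - z` lie in the right half plane where it is used). -/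
def vacIntegrand (A : ℝ) (J : ℤ) (βL z : ℂ) : ℂ :=
  Complex.exp (z * J) * (4 * π ^ 2 / (z * (βL - z))) ^ (1 / 2 : ℂ) *
    Complex.exp (4 * π ^ 2 * A / (βL - z) + 4 * π ^ 2 * A / z) *
    (1 - Complex.exp (-(4 * π ^ 2 / (βL - z)))) * (1 - Complex.exp (-(4 * π ^ 2 / z)))

/-- The vacuum term `F_vac(β_L, J) = ∫ dz / (2πi) (...)` along the segment `z = α + it`,
`-π ≤ t ≤ π`; along it `dz / (2πi) = dt / (2π)`. -/
def Fvac (A : ℝ) (βL : ℂ) (J : ℤ) : ℂ :=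
  ∫ t in (-π)..π, (1 / (2 * π) : ℂ) *
    vacIntegrand A J βL ((alphaJ A J : ℂ) + (t : ℂ) * Complex.I)

/-- The integrand `(2π)⁻¹ F_vac(β + is, J) e^{(β + is)(h - A)}` of the inverse Laplace transform. -/
def rhoVacIntegrand (A β : ℝ) (J : ℤ) (h s : ℝ) : ℂ :=
  (1 / (2 * π) : ℂ) * Fvac A ((β : ℂ) + (s : ℂ) * Complex.I) J *
    Complex.exp (((β : ℂ) + (s : ℂ) * Complex.I) * ((h : ℂ) - A))

/-- The vacuum density `ρ_{J,vac}(J + 2h)`, defined by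
`2 ρ_{J,vac}(J + 2h) = ∫ ds / (2π) F_vac(β + is, J) e^{(β + is)(h - A)}`. The abscissa `β` of the
inverse Laplace transform is any number `β > α = 2π √(A / J)`. -/
def rhoVac (A β : ℝ) (J : ℤ) (h : ℝ) : ℂ :=
  (1 / 2 : ℂ) * ∫ s : ℝ, rhoVacIntegrand A β J h s

/-- The rescaled and translated test function `φ_{h⋆,λ}(h) = λ⁻¹ φ((h - h⋆) / λ)`. -/
def rescale (φ : ℝ → ℂ) (hstar lam : ℝ) (h : ℝ) : ℂ :=
  (lam : ℂ)⁻¹ * φ ((h - hstar) / lam)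

end

/-! Evaluate the reduced partition function (`Z` without the eta factors) at `(β_L - z, z)`. A
primary of spin `K` then depends on `z` only through `e^{-Kz}`, so integrating against `e^{zJ}` over
one period `z = α + it` isolates the Laplace transform of the spin-`J` measure; the vacuum drops out
for `J ≥ 2`. Modular S-invariance turns the same integrand into the dual vacuum, whose integral is
exactly `Fvac`, plus the dual primaries. `laplaceRemainder` is therefore an integral over dual
primaries only.

At `α = 2π√(A/J)` the vacuum has size `e^{4π√(AJ)}` up to powers of `J`. By the twist gap near `t =
0`, and by a second inversion away from it, the dual primaries are smaller by `e^{-κ/α}`, that is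
`e^{-κ'√J}`, at the cost of a factor `e^{K(1+s²)}` where `s = Im β_L` (`exp_mul_realPrimarySum_le`,
`norm_laplaceRemainder_le`). Positivity of the measure also bounds the remainder uniformly in `s`,
without the exponential gain (`norm_laplaceRemainder_le_const`).

By Fourier inversion the difference to be estimated is the integral over `s` of the remainder
against the transform of the test function (`difference_eq`), which decays like `(λ|β + is|)^{-N}`
for every `N`. Cut at `|s| = T = J^{1/4-ε/2}`. Below the cut `T² = J^{1/2-ε}` is negligible against
`√J`, so the first bound wins; above it `λT ≥ δJ^{ε/2}`, so a large `N` beats any power of `J`.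

Restricting to `h > Tgap` loses nothing: the vacuum density vanishes for `h ≤ A`, and modular
invariance forces `Tgap ≤ A` (`Tgap_le_A`). -/

/-- The image of `ρ_J(Δ) dΔ` under `Δ ↦ h = (Δ - J) / 2`. -/
noncomputable def CFTData.twistMeasure (S : CFTData) (J : ℤ) : Measure ℝ :=
  (S.rho J).map fun Δ : ℝ => (Δ - J) / 2

/-- The Laplace transform `∫ e^{-hw}` of the twist measure of spin `J`. -/
noncomputable def CFTData.laplace (S : CFTData) (J : ℤ) (w : ℂ) : ℂ :=
  ∫ h, Complex.exp (-(h : ℂ) * w) ∂S.twistMeasure J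

/-- The contribution of the non-identity primaries to the reduced partition function. -/
noncomputable def CFTData.primarySum (S : CFTData) (βL βR : ℂ) : ℂ :=
  ∫ x, Complex.exp (-(x.1 : ℂ) * βL - (x.2 : ℂ) * βR) ∂S.pairDensity

/-- `CFTData.primarySum` at real arguments. -/
noncomputable def CFTData.realPrimarySum (S : CFTData) (a b : ℝ) : ℝ :=
  ∫ x, Real.exp (-x.1 * a - x.2 * b) ∂S.pairDensity

/-! ### Spectral measures: gap, positivity and convergence -/

namespace CFTData.IsModularCFT

variable {S : CFTData}

theorem A_pos (hS : S.IsModularCFT) : 0 < S.A := by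
  have := hS.one_lt_c
  unfold CFTData.A
  linarith

theorem ae_rho (hS : S.IsModularCFT) (J : ℤ) :
    ∀ᵐ Δ ∂S.rho J, |(J : ℝ)| + 2 * S.Tgap < Δ := by
  filter_upwards [measure_eq_zero_iff_ae_notMem.1 (hS.twist_gap J)] with Δ h
  simpa using h

theorem ae_twistMeasure (hS : S.IsModularCFT) (J : ℤ) :
    ∀ᵐ h ∂S.twistMeasure J, S.Tgap < h := by
  unfold CFTData.twistMeasure
  rw [ae_map_iff (by fun_prop) (measurableSet_lt (by fun_prop) (by fun_prop))]
  filter_upwards [hS.ae_rho J] with Δ h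
  have := le_abs_self (J : ℝ)
  linarith

theorem ae_pairDensity (hS : S.IsModularCFT) :
    ∀ᵐ x ∂S.pairDensity, x ∈ Ioi S.Tgap ×ˢ Ioi S.Tgap := by
  unfold CFTData.pairDensity
  rw [Measure.ae_sum_iff]
  intro J
  refine (ae_map_iff (p := fun x : ℝ × ℝ => x ∈ Ioi S.Tgap ×ˢ Ioi S.Tgap) (by fun_prop)
    (measurableSet_Ioi.prod measurableSet_Ioi)).2 ?_
  filter_upwards [hS.ae_rho J] with Δ h
  have := le_abs_self (J : ℝ)
  have := neg_le_abs (J : ℝ)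
  rw [mem_prod, mem_Ioi, mem_Ioi]
  constructor <;> simp only <;> linarith

theorem integrable_real (hS : S.IsModularCFT) {a b : ℝ} (ha : 0 < a) (hb : 0 < b) :
    Integrable (fun x : ℝ × ℝ => Real.exp (-x.1 * a - x.2 * b)) S.pairDensity := by
  refine ⟨by fun_prop, ?_⟩
  rw [hasFiniteIntegral_iff_ofReal (Eventually.of_forall fun _ => (Real.exp_pos _).le)]
  -- With `h = (Δ - J)/2` and `h̄ = (Δ + J)/2`, `ah + bh̄ = βΔ + μJ` for these `β`, `μ`, and `|μ| <
  -- β` says that `a` and `b` are positive.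
  have h := hS.convergent ((a + b) / 2) ((b - a) / 2)
    (by rw [abs_lt]; constructor <;> linarith)
  rw [lt_top_iff_ne_top]
  convert h using 1
  unfold CFTData.pairDensity
  rw [lintegral_sum_measure]
  congr 1
  ext J
  rw [lintegral_map (by fun_prop) (by fun_prop)]
  congr 1
  ext Δ
  congr 2
  ring

theorem norm_exp_pair (x : ℝ × ℝ) (βL βR : ℂ) :
    ‖Complex.exp (-(x.1 : ℂ) * βL - (x.2 : ℂ) * βR)‖ =
      Real.exp (-x.1 * βL.re - x.2 * βR.re) := by
  rw [Complex.norm_exp]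
  simp

theorem integrable_pair (hS : S.IsModularCFT) {βL βR : ℂ} (hL : 0 < βL.re) (hR : 0 < βR.re) :
    Integrable (fun x : ℝ × ℝ => Complex.exp (-(x.1 : ℂ) * βL - (x.2 : ℂ) * βR))
      S.pairDensity := by
  refine (hS.integrable_real hL hR).mono' (by fun_prop) (Eventually.of_forall fun x => ?_)
  rw [norm_exp_pair]

theorem norm_primarySum_le {βL βR : ℂ} :
    ‖S.primarySum βL βR‖ ≤ S.realPrimarySum βL.re βR.re := by
  refine (norm_integral_le_integral_norm _).trans_eq ?_
  simp_rw [norm_exp_pair]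
  rfl

theorem primarySum_ofReal (a b : ℝ) : S.primarySum a b = (S.realPrimarySum a b : ℂ) := by
  unfold CFTData.primarySum CFTData.realPrimarySum
  rw [← integral_complex_ofReal]
  congr 1
  ext x
  push_cast
  rfl

theorem realPrimarySum_nonneg (a b : ℝ) : 0 ≤ S.realPrimarySum a b :=
  integral_nonneg fun _ => (Real.exp_pos _).le

theorem realPrimarySum_le_left (hS : S.IsModularCFT) {a a' b : ℝ} (ha : 0 < a) (haa : a ≤ a')
    (hb : 0 < b) :
    S.realPrimarySum a' b ≤ Real.exp (-S.Tgap * (a' - a)) * S.realPrimarySum a b := by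
  unfold CFTData.realPrimarySum
  rw [← integral_const_mul]
  refine integral_mono_ae (hS.integrable_real (ha.trans_le haa) hb)
    ((hS.integrable_real ha hb).const_mul _) ?_
  filter_upwards [hS.ae_pairDensity] with x hx
  rw [← Real.exp_add]
  apply Real.exp_le_exp.2
  have := mem_Ioi.1 hx.1
  nlinarith

theorem realPrimarySum_le_right (hS : S.IsModularCFT) {a b b' : ℝ} (ha : 0 < a) (hb : 0 < b)
    (hbb : b ≤ b') :
    S.realPrimarySum a b' ≤ Real.exp (-S.Tgap * (b' - b)) * S.realPrimarySum a b := by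
  unfold CFTData.realPrimarySum
  rw [← integral_const_mul]
  refine integral_mono_ae (hS.integrable_real ha (hb.trans_le hbb))
    ((hS.integrable_real ha hb).const_mul _) ?_
  filter_upwards [hS.ae_pairDensity] with x hx
  rw [← Real.exp_add]
  apply Real.exp_le_exp.2
  have := mem_Ioi.1 hx.2
  nlinarith

theorem realPrimarySum_anti (hS : S.IsModularCFT) {a a' b b' : ℝ} (ha : 0 < a) (haa : a ≤ a')
    (hb : 0 < b) (hbb : b ≤ b') : S.realPrimarySum a' b' ≤ S.realPrimarySum a b := by
  refine integral_mono_ae (hS.integrable_real (ha.trans_le haa) (hb.trans_le hbb))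
    (hS.integrable_real ha hb) ?_
  filter_upwards [hS.ae_pairDensity] with x hx
  have := hS.Tgap_pos
  apply Real.exp_le_exp.2
  have := mem_Ioi.1 hx.1
  have := mem_Ioi.1 hx.2
  nlinarith

theorem integral_restrict_pair (hS : S.IsModularCFT) (βL βR : ℂ) :
    ∫ x in Ioi S.Tgap ×ˢ Ioi S.Tgap,
      Complex.exp (-(x.1 : ℂ) * βL - (x.2 : ℂ) * βR) ∂S.pairDensity = S.primarySum βL βR := by
  unfold CFTData.primarySum
  rw [Measure.restrict_eq_self_of_ae_mem]
  filter_upwards [hS.ae_pairDensity] with x hx using hx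

/-- On the spin-`J` line `h̄ = h + J`, so the exponent splits into `-Jβ_R` and `-h(β_L + β_R)`. At
fixed `β_L + β_R` the sum is a Laurent series in `e^{-β_R}`, which makes spin a Fourier variable. -/
theorem hasSum_primarySum (hS : S.IsModularCFT) {βL βR : ℂ} (hL : 0 < βL.re) (hR : 0 < βR.re) :
    HasSum (fun J : ℤ => Complex.exp (-(J : ℂ) * βR) * S.laplace J (βL + βR))
      (S.primarySum βL βR) := by
  have h := hasSum_integral_measure (hS.integrable_pair hL hR)
  refine h.congr_fun fun J => ?_
  unfold CFTData.laplace CFTData.twistMeasure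
  rw [integral_map (by fun_prop) (by fun_prop), integral_map (by fun_prop) (by fun_prop),
    ← integral_const_mul]
  congr 1
  ext Δ
  rw [← Complex.exp_add]
  congr 1
  push_cast
  ring

theorem integrable_twist (hS : S.IsModularCFT) (J : ℤ) {w : ℝ} (hw : 0 < w) :
    Integrable (fun h : ℝ => Real.exp (-h * w)) (S.twistMeasure J) := by
  have h : Integrable (fun x : ℝ × ℝ => Real.exp (-x.1 * (w / 2) - x.2 * (w / 2)))
      ((S.rho J).map fun Δ : ℝ => ((Δ - J) / 2, (Δ + J) / 2)) :=
    -- A single spin is one summand of the positive measure `pairDensity`, so it inherits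
    -- integrability.
    (hS.integrable_real (half_pos hw) (half_pos hw)).mono_measure
      (Measure.le_sum (fun J : ℤ => (S.rho J).map fun Δ : ℝ => ((Δ - J) / 2, (Δ + J) / 2)) J)
  unfold CFTData.twistMeasure
  rw [integrable_map_measure (by fun_prop) (by fun_prop)] at h ⊢
  convert h.const_mul (Real.exp (J * (w / 2))) using 2 with Δ
  simp only [Function.comp_apply]
  rw [← Real.exp_add]
  congr 1
  ring

theorem norm_exp_twist (h : ℝ) (w : ℂ) :
    ‖Complex.exp (-(h : ℂ) * w)‖ = Real.exp (-h * w.re) := by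
  rw [Complex.norm_exp]
  simp

/-- Positivity of the measure: oscillation on a vertical line can only decrease the transform. -/
theorem norm_laplace_le (J : ℤ) (w : ℂ) :
    ‖S.laplace J w‖ ≤ ‖S.laplace J (w.re : ℂ)‖ := by
  refine (norm_integral_le_integral_norm _).trans ?_
  simp_rw [norm_exp_twist]
  refine (le_abs_self _).trans_eq ?_
  rw [← Real.norm_eq_abs, ← Complex.norm_real, ← integral_complex_ofReal]
  unfold CFTData.laplace
  congr 2
  ext h
  push_cast
  rfl

theorem isFiniteMeasureOnCompacts_twist (hS : S.IsModularCFT) (J : ℤ) :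
    IsFiniteMeasureOnCompacts (S.twistMeasure J) := by
  refine ⟨fun K hK => ?_⟩
  obtain ⟨M, hM⟩ := hK.bddAbove
  have h := (hS.integrable_twist J one_pos).measure_ge_lt_top (Real.exp_pos (-M))
  refine (measure_mono fun x hx => ?_).trans_lt h
  simpa using hM hx

end CFTData.IsModularCFT

/-! ### Principal branches and the inversion of eta -/

theorem Complex.mul_cpow_of_arg_add {x y : ℂ} (hx : x ≠ 0) (hy : y ≠ 0)
    (h : x.arg + y.arg ∈ Ioc (-π) π) (r : ℂ) : (x * y) ^ r = x ^ r * y ^ r := by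
  rw [Complex.cpow_def_of_ne_zero (mul_ne_zero hx hy), Complex.cpow_def_of_ne_zero hx,
    Complex.cpow_def_of_ne_zero hy, Complex.log_mul hx hy h, add_mul, Complex.exp_add]

theorem Complex.abs_arg_lt_of_re_pos {z : ℂ} (hz : 0 < z.re) : |z.arg| < π / 2 :=
  Complex.abs_arg_lt_pi_div_two_iff.2 (Or.inl hz)

theorem Complex.arg_mul_of_re_pos {z w : ℂ} (hz : 0 < z.re) (hw : 0 < w.re) :
    (z * w).arg = z.arg + w.arg ∧ |z.arg + w.arg| < π := by
  have h1 := Complex.abs_arg_lt_of_re_pos hz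
  have h2 := Complex.abs_arg_lt_of_re_pos hw
  have h3 := abs_add_le z.arg w.arg
  have h : |z.arg + w.arg| < π := by linarith
  exact ⟨Complex.arg_mul (Complex.ne_zero_of_re_pos hz) (Complex.ne_zero_of_re_pos hw)
    ⟨(abs_lt.1 h).1, (abs_lt.1 h).2.le⟩, h⟩

theorem Complex.mul_mem_slitPlane_of_re_pos {z w : ℂ} (hz : 0 < z.re) (hw : 0 < w.re) :
    z * w ∈ Complex.slitPlane := by
  obtain ⟨h1, h2⟩ := Complex.arg_mul_of_re_pos hz hw
  refine Complex.mem_slitPlane_iff_arg.2 ⟨?_, mul_ne_zero (Complex.ne_zero_of_re_pos hz)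
    (Complex.ne_zero_of_re_pos hw)⟩
  rw [h1]
  exact (lt_of_abs_lt h2).ne

theorem Complex.four_pi_sq_div_mem_slitPlane {z : ℂ} (hz : z ∈ Complex.slitPlane) :
    4 * (π : ℂ) ^ 2 / z ∈ Complex.slitPlane := by
  obtain ⟨h1, h2⟩ := Complex.mem_slitPlane_iff_arg.1 hz
  have h3 : z⁻¹ ∈ Complex.slitPlane := by
    refine Complex.mem_slitPlane_iff_arg.2 ⟨?_, inv_ne_zero h2⟩
    rw [Complex.arg_inv, if_neg h1]
    intro h
    have := Complex.neg_pi_lt_arg z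
    linarith
  have h4 : 4 * (π : ℂ) ^ 2 / z = ((4 * π ^ 2 : ℝ) : ℂ) * z⁻¹ := by
    push_cast
    rw [div_eq_mul_inv]
  have h5 : (0 : ℝ) < 4 * π ^ 2 := by positivity
  rw [h4, Complex.mem_slitPlane_iff_arg, Complex.arg_real_mul _ h5]
  exact ⟨(Complex.mem_slitPlane_iff_arg.1 h3).1,
    mul_ne_zero (by exact_mod_cast h5.ne') (inv_ne_zero h2)⟩

/-- In the right half plane the two arguments add to less than `π` in modulus, so principal square
roots are multiplicative. This matches the two weight-1/2 eta factors with the single root in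
`vacIntegrand`. -/
theorem Complex.four_pi_sq_div_mul_cpow {z w : ℂ} (hz : 0 < z.re) (hw : 0 < w.re) :
    (4 * (π : ℂ) ^ 2 / (z * w)) ^ (1 / 2 : ℂ) *
      ((z / (2 * π)) ^ (1 / 2 : ℂ) * (w / (2 * π)) ^ (1 / 2 : ℂ)) = 1 := by
  have hp : (0 : ℝ) < (2 * π)⁻¹ := by positivity
  have hre : ∀ u : ℂ, 0 < u.re → 0 < (u / (2 * π)).re := by
    intro u hu
    have : u / (2 * π) = ((2 * π)⁻¹ : ℝ) * u := by
      push_cast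
      rw [div_eq_inv_mul]
    rw [this, Complex.re_ofReal_mul]
    positivity
  obtain ⟨h1, h2⟩ := Complex.arg_mul_of_re_pos (hre z hz) (hre w hw)
  have hz0 := Complex.ne_zero_of_re_pos (hre z hz)
  have hw0 := Complex.ne_zero_of_re_pos (hre w hw)
  rw [← Complex.mul_cpow_of_arg_add hz0 hw0 ⟨(abs_lt.1 h2).1, (abs_lt.1 h2).2.le⟩]
  have h3 : 4 * (π : ℂ) ^ 2 / (z * w) = (z / (2 * π) * (w / (2 * π)))⁻¹ := by
    have := Complex.ne_zero_of_re_pos hz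
    have := Complex.ne_zero_of_re_pos hw
    field_simp
    norm_num
  rw [h3, Complex.inv_cpow _ _ (by rw [h1]; exact (lt_of_abs_lt h2).ne)]
  refine inv_mul_cancel₀ ?_
  rw [Complex.cpow_ne_zero_iff]
  exact Or.inl (mul_ne_zero hz0 hw0)

theorem etaBeta_inversion {b : ℂ} (hb : 0 < b.re) :
    etaBeta (4 * π ^ 2 / b) = (b / (2 * π)) ^ (1 / 2 : ℂ) * etaBeta b := by
  have hb0 := Complex.ne_zero_of_re_pos hb
  have hpi : (π : ℂ) ≠ 0 := by exact_mod_cast Real.pi_ne_zero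
  have hre : 0 < (b / (2 * π)).re := by
    have : b / (2 * π) = ((2 * π)⁻¹ : ℝ) * b := by
      push_cast
      rw [div_eq_inv_mul]
    rw [this, Complex.re_ofReal_mul]
    positivity
  set z : ℂ := b / (2 * π) with hz
  have h1 : Complex.I * b / (2 * π) = Complex.I * z := by rw [hz, mul_div_assoc]
  have h2 : Complex.I * (4 * π ^ 2 / b) / (2 * π) = -1 / (Complex.I * z) := by
    rw [hz]
    field_simp
    rw [Complex.I_sq]
    norm_num
  unfold etaBeta
  rw [h1, h2]
  have h3 := ModularForm.eta_comp_eq_csqrt_I_inv (x := Complex.I * z) (by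
    simpa [UpperHalfPlane.upperHalfPlaneSet] using hre)
  simp only [Function.comp_apply, Pi.smul_apply, Pi.mul_apply, smul_eq_mul] at h3
  rw [h3]
  have harg := abs_lt.1 (Complex.abs_arg_lt_of_re_pos hre)
  have h4 : Complex.sqrt (Complex.I * z) = Complex.sqrt Complex.I * z ^ (1 / 2 : ℂ) := by
    unfold Complex.sqrt
    rw [← one_div, Complex.mul_cpow_of_arg_add Complex.I_ne_zero
      (Complex.ne_zero_of_re_pos hre)]
    rw [Complex.arg_I]
    constructor <;> linarith [Real.pi_pos]
  have h5 : Complex.sqrt Complex.I ≠ 0 := by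
    unfold Complex.sqrt
    rw [Complex.cpow_ne_zero_iff]
    exact Or.inl Complex.I_ne_zero
  rw [h4]
  field_simp

theorem etaBeta_ne_zero {b : ℂ} (hb : 0 < b.re) : etaBeta b ≠ 0 := by
  refine ModularForm.eta_ne_zero ?_
  have h1 : Complex.I * b / (2 * π) = ((2 * π)⁻¹ : ℝ) * (Complex.I * b) := by
    push_cast
    rw [div_eq_inv_mul]
  have : 0 < (Complex.I * b / (2 * π)).im := by
    rw [h1, Complex.im_ofReal_mul]
    have : (Complex.I * b).im = b.re := by simp
    rw [this]
    positivity
  simpa [UpperHalfPlane.upperHalfPlaneSet] using this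

theorem Complex.re_four_pi_sq_div (z : ℂ) :
    (4 * (π : ℂ) ^ 2 / z).re = 4 * π ^ 2 * z.re / Complex.normSq z := by
  have : 4 * (π : ℂ) ^ 2 / z = ((4 * π ^ 2 : ℝ) : ℂ) * z⁻¹ := by
    push_cast
    rw [div_eq_mul_inv]
  rw [this, Complex.re_ofReal_mul, Complex.inv_re, mul_div_assoc]

theorem Complex.re_four_pi_sq_div_pos {z : ℂ} (hz : 0 < z.re) :
    0 < (4 * (π : ℂ) ^ 2 / z).re := by
  rw [Complex.re_four_pi_sq_div]
  have := Complex.normSq_pos.2 (Complex.ne_zero_of_re_pos hz)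
  positivity

/-! ### The reduced partition function under S -/

/-- The partition function of primaries, `η(β_L) η(β_R) Z(β_L, β_R)`. -/
noncomputable def CFTData.reducedZ (S : CFTData) (βL βR : ℂ) : ℂ :=
  Complex.exp (S.A * (βL + βR)) *
    ((1 - Complex.exp (-βL)) * (1 - Complex.exp (-βR)) + S.primarySum βL βR)

namespace CFTData.IsModularCFT

variable {S : CFTData}

theorem Z_eq (hS : S.IsModularCFT) (βL βR : ℂ) :
    S.Z βL βR = S.reducedZ βL βR / (etaBeta βL * etaBeta βR) := by
  unfold CFTData.Z CFTData.reducedZ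
  rw [hS.integral_restrict_pair]
  ring

/-- The eta functions do not vanish and cancel from S-invariance of `Z`, leaving only their
automorphy factors. -/
theorem reducedZ_inversion (hS : S.IsModularCFT) {βL βR : ℂ} (hL : 0 < βL.re)
    (hR : 0 < βR.re) :
    S.reducedZ βL βR = (4 * π ^ 2 / (βL * βR)) ^ (1 / 2 : ℂ) *
      S.reducedZ (4 * π ^ 2 / βL) (4 * π ^ 2 / βR) := by
  have h := hS.modular_S βL βR hL hR
  rw [hS.Z_eq, hS.Z_eq, etaBeta_inversion hL, etaBeta_inversion hR] at h
  have h1 := etaBeta_ne_zero hL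
  have h2 := etaBeta_ne_zero hR
  have h3 := Complex.four_pi_sq_div_mul_cpow hL hR
  have h4 : (βL / (2 * π)) ^ (1 / 2 : ℂ) ≠ 0 := by
    intro h0
    rw [h0] at h3
    simp only [zero_mul, mul_zero, zero_ne_one] at h3
  have h5 : (βR / (2 * π)) ^ (1 / 2 : ℂ) ≠ 0 := by
    intro h0
    rw [h0] at h3
    simp only [mul_zero, zero_ne_one] at h3
  rw [div_eq_div_iff (by positivity) (by positivity)] at h
  have h6 : S.reducedZ (4 * π ^ 2 / βL) (4 * π ^ 2 / βR) =
      S.reducedZ βL βR * ((βL / (2 * π)) ^ (1 / 2 : ℂ) * (βR / (2 * π)) ^ (1 / 2 : ℂ)) :=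
    mul_right_cancel₀ (mul_ne_zero h1 h2) (by rw [h]; ring)
  rw [h6]
  linear_combination (-S.reducedZ βL βR) * h3

end CFTData.IsModularCFT

/-! ### Extracting a spin as a Fourier mode -/

theorem intervalIntegral_exp_int_mul (α : ℝ) (n : ℤ) :
    ∫ t in (-π)..π, Complex.exp (((α : ℂ) + (t : ℂ) * Complex.I) * n) =
      if n = 0 then 2 * (π : ℂ) else 0 := by
  split_ifs with hn
  · subst hn
    simp
    ring
  · have hc : (n : ℂ) * Complex.I ≠ 0 :=
      mul_ne_zero (Int.cast_ne_zero.2 hn) Complex.I_ne_zero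
    have h1 : ∀ t : ℝ, Complex.exp (((α : ℂ) + (t : ℂ) * Complex.I) * n) =
        Complex.exp (α * n) * Complex.exp (n * Complex.I * t) := by
      intro t
      rw [← Complex.exp_add]
      congr 1
      ring
    simp_rw [h1]
    rw [intervalIntegral.integral_const_mul, integral_exp_mul_complex hc]
    have h2 : Complex.exp (n * Complex.I * (π : ℝ)) =
        Complex.exp (n * Complex.I * ((-π : ℝ) : ℂ)) := by
      rw [Complex.exp_eq_exp_iff_exists_int]
      refine ⟨n, ?_⟩
      push_cast
      ring
    rw [h2, sub_self, zero_div, mul_zero]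

theorem continuous_exp_segment (α : ℝ) (n : ℤ) :
    Continuous fun t : ℝ => Complex.exp (((α : ℂ) + (t : ℂ) * Complex.I) * n) := by
  fun_prop

namespace CFTData.IsModularCFT

variable {S : CFTData}

/-- Termwise integration of the Laurent series in `e^{-z}`: only the term `K = J` survives. Absolute
convergence at `t = 0` dominates the whole segment. -/
theorem integral_fourier_mode (hS : S.IsModularCFT) {α : ℝ} (hα : 0 < α) {βL : ℂ}
    (hβ : α < βL.re) (J : ℤ) :
    ∫ t in (-π)..π, Complex.exp (((α : ℂ) + (t : ℂ) * Complex.I) * J) *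
      S.primarySum (βL - ((α : ℂ) + (t : ℂ) * Complex.I)) ((α : ℂ) + (t : ℂ) * Complex.I) =
      2 * π * S.laplace J βL := by
  have hs : ∀ t : ℝ, HasSum
      (fun K : ℤ => Complex.exp (((α : ℂ) + (t : ℂ) * Complex.I) * ((J - K : ℤ) : ℂ)) *
        S.laplace K βL)
      (Complex.exp (((α : ℂ) + (t : ℂ) * Complex.I) * J) *
      S.primarySum (βL - ((α : ℂ) + (t : ℂ) * Complex.I)) ((α : ℂ) + (t : ℂ) * Complex.I)) := by
    intro t
    have h := (hS.hasSum_primarySum (βL := βL - ((α : ℂ) + (t : ℂ) * Complex.I))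
      (βR := (α : ℂ) + (t : ℂ) * Complex.I) (by simpa using hβ) (by simpa using hα)).mul_left
      (Complex.exp (((α : ℂ) + (t : ℂ) * Complex.I) * J))
    refine h.congr_fun fun K => ?_
    rw [← mul_assoc, ← Complex.exp_add, sub_add_cancel]
    congr 2
    push_cast
    ring
  have hn : ∀ (K : ℤ) (t : ℝ),
      ‖Complex.exp (((α : ℂ) + (t : ℂ) * Complex.I) * ((J - K : ℤ) : ℂ)) * S.laplace K βL‖ =
      ‖Complex.exp (((α : ℂ) + ((0 : ℝ) : ℂ) * Complex.I) * ((J - K : ℤ) : ℂ)) *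
        S.laplace K βL‖ := by
    intro K t
    rw [norm_mul, norm_mul, Complex.norm_exp, Complex.norm_exp]
    simp
  have h := intervalIntegral.hasSum_integral_of_dominated_convergence (μ := volume)
    (a := -π) (b := π)
    (F := fun (K : ℤ) (t : ℝ) =>
      Complex.exp (((α : ℂ) + (t : ℂ) * Complex.I) * ((J - K : ℤ) : ℂ)) * S.laplace K βL)
    (fun K _ => ‖Complex.exp (((α : ℂ) + ((0 : ℝ) : ℂ) * Complex.I) * ((J - K : ℤ) : ℂ)) *
        S.laplace K βL‖)
    (fun K => ((continuous_exp_segment α (J - K)).mul continuous_const).aestronglyMeasurable)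
    (fun K => Eventually.of_forall fun t _ => (hn K t).le)
    (Eventually.of_forall fun t _ => (hs 0).summable.norm)
    intervalIntegrable_const
    (Eventually.of_forall fun t _ => hs t)
  refine h.unique ?_
  have h2 : (fun K : ℤ => ∫ t in (-π)..π,
      Complex.exp (((α : ℂ) + (t : ℂ) * Complex.I) * ((J - K : ℤ) : ℂ)) * S.laplace K βL) =
      fun K => if K = J then 2 * π * S.laplace J βL else 0 := by
    ext K
    rw [intervalIntegral.integral_mul_const, intervalIntegral_exp_int_mul]
    by_cases hK : K = J
    · simp [hK]
    · rw [if_neg hK, if_neg (fun h => hK (by omega)), zero_mul]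
  rw [h2]
  exact hasSum_ite_eq J _

theorem continuous_primarySum_segment (hS : S.IsModularCFT) {α : ℝ} (hα : 0 < α) {βL : ℂ}
    (hβ : α < βL.re) :
    Continuous fun t : ℝ =>
      S.primarySum (βL - ((α : ℂ) + (t : ℂ) * Complex.I)) ((α : ℂ) + (t : ℂ) * Complex.I) := by
  refine continuous_of_dominated (bound := fun x : ℝ × ℝ =>
    Real.exp (-x.1 * (βL.re - α) - x.2 * α)) (fun t => by fun_prop) (fun t => ?_)
    (hS.integrable_real (by linarith) hα) (Eventually.of_forall fun x => by fun_prop)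
  refine Eventually.of_forall fun x => ?_
  rw [norm_exp_pair]
  simp

/-- The vacuum product contributes only the frequencies `J - 1`, `J`, `J + 1`, all nonzero once `J ≥
2`, so it integrates to zero. -/
theorem integral_reducedZ_segment (hS : S.IsModularCFT) {α : ℝ} (hα : 0 < α) {βL : ℂ}
    (hβ : α < βL.re) {J : ℤ} (hJ : 2 ≤ J) :
    ∫ t in (-π)..π, Complex.exp (((α : ℂ) + (t : ℂ) * Complex.I) * J) *
      S.reducedZ (βL - ((α : ℂ) + (t : ℂ) * Complex.I)) ((α : ℂ) + (t : ℂ) * Complex.I) =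
      2 * π * (Complex.exp (S.A * βL) * S.laplace J βL) := by
  have h1 : ∀ t : ℝ, Complex.exp (((α : ℂ) + (t : ℂ) * Complex.I) * J) *
      S.reducedZ (βL - ((α : ℂ) + (t : ℂ) * Complex.I)) ((α : ℂ) + (t : ℂ) * Complex.I) =
      Complex.exp (S.A * βL) *
        (((1 + Complex.exp (-βL)) * Complex.exp (((α : ℂ) + (t : ℂ) * Complex.I) * J) -
          Complex.exp (-βL) * Complex.exp (((α : ℂ) + (t : ℂ) * Complex.I) * ((J + 1 : ℤ) : ℂ)) -
          Complex.exp (((α : ℂ) + (t : ℂ) * Complex.I) * ((J - 1 : ℤ) : ℂ))) +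
        Complex.exp (((α : ℂ) + (t : ℂ) * Complex.I) * J) *
      S.primarySum (βL - ((α : ℂ) + (t : ℂ) * Complex.I)) ((α : ℂ) + (t : ℂ) * Complex.I)) := by
    intro t
    unfold CFTData.reducedZ
    set z : ℂ := (α : ℂ) + (t : ℂ) * Complex.I
    have e1 : Complex.exp (z * ((J + 1 : ℤ) : ℂ)) = Complex.exp (z * J) * Complex.exp z := by
      rw [← Complex.exp_add]
      push_cast
      ring_nf
    have e2 : Complex.exp (z * ((J - 1 : ℤ) : ℂ)) = Complex.exp (z * J) * Complex.exp (-z) := by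
      rw [← Complex.exp_add]
      push_cast
      ring_nf
    have e3 : Complex.exp (-(βL - z)) = Complex.exp (-βL) * Complex.exp z := by
      rw [← Complex.exp_add]
      ring_nf
    have e4 : Complex.exp z * Complex.exp (-z) = 1 := by
      rw [← Complex.exp_add]
      simp
    rw [e1, e2, e3, sub_add_cancel]
    linear_combination (Complex.exp (S.A * βL) * Complex.exp (z * J) * Complex.exp (-βL)) * e4
  simp_rw [h1]
  have hc := fun n : ℤ => (continuous_exp_segment α n).intervalIntegrable (μ := volume) (-π) π
  rw [intervalIntegral.integral_const_mul, intervalIntegral.integral_add,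
    intervalIntegral.integral_sub, intervalIntegral.integral_sub,
    intervalIntegral.integral_const_mul, intervalIntegral.integral_const_mul,
    intervalIntegral_exp_int_mul, intervalIntegral_exp_int_mul, intervalIntegral_exp_int_mul,
    hS.integral_fourier_mode hα hβ, if_neg (by omega), if_neg (by omega), if_neg (by omega)]
  · ring
  · exact (hc _).const_mul _
  · exact (hc _).const_mul _
  · exact ((hc _).const_mul _).sub ((hc _).const_mul _)
  · exact hc _
  · exact (((hc _).const_mul _).sub ((hc _).const_mul _)).sub (hc _)
  · exact ((continuous_exp_segment α J).mul
      (hS.continuous_primarySum_segment hα hβ)).intervalIntegrable _ _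

end CFTData.IsModularCFT

/-! ### Modular bounds for the primaries at real temperatures -/

theorem Complex.norm_four_pi_sq_div_cpow (z : ℂ) :
    ‖(4 * (π : ℂ) ^ 2 / z) ^ (1 / 2 : ℂ)‖ = √(4 * π ^ 2 / ‖z‖) := by
  have h : (1 / 2 : ℂ) = ((1 / 2 : ℝ) : ℂ) := by push_cast; rfl
  rw [h, Complex.norm_cpow_real, Real.sqrt_eq_rpow, norm_div, norm_mul, norm_pow,
    Complex.norm_real, Real.norm_of_nonneg Real.pi_pos.le]
  norm_num

theorem Real.sqrt_le_self_of_one_le {x : ℝ} (hx : 1 ≤ x) : √x ≤ x :=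
  Real.sqrt_le_iff.2 ⟨by linarith, by nlinarith⟩

theorem Real.le_exp_self (x : ℝ) : x ≤ Real.exp x := by
  linarith [Real.add_one_le_exp x]

theorem Real.div_one_add_le_one_sub_exp_neg {v : ℝ} (hv : 0 ≤ v) :
    v / (1 + v) ≤ 1 - Real.exp (-v) := by
  have e1 : Real.exp (-v) ≤ 1 / (1 + v) := by
    rw [Real.exp_neg, ← one_div]
    exact one_div_le_one_div_of_le (by linarith) (by linarith [Real.add_one_le_exp v])
  have e2 : v / (1 + v) = 1 - 1 / (1 + v) := by field_simp; ring
  linarith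

namespace CFTData.IsModularCFT

variable {S : CFTData}

theorem real_inversion (hS : S.IsModularCFT) {a b : ℝ} (ha : 0 < a) (hb : 0 < b) :
    Real.exp (S.A * (a + b)) *
        ((1 - Real.exp (-a)) * (1 - Real.exp (-b)) + S.realPrimarySum a b) =
      √(4 * π ^ 2 / (a * b)) * (Real.exp (S.A * (4 * π ^ 2 / a + 4 * π ^ 2 / b)) *
        ((1 - Real.exp (-(4 * π ^ 2 / a))) * (1 - Real.exp (-(4 * π ^ 2 / b))) +
          S.realPrimarySum (4 * π ^ 2 / a) (4 * π ^ 2 / b))) := by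
  have key : ∀ x y : ℝ, 0 < x → 0 < y → ‖S.reducedZ x y‖ = Real.exp (S.A * (x + y)) *
        ((1 - Real.exp (-x)) * (1 - Real.exp (-y)) + S.realPrimarySum x y) := by
    intro x y hx hy
    have h : S.reducedZ x y = ((Real.exp (S.A * (x + y)) *
        ((1 - Real.exp (-x)) * (1 - Real.exp (-y)) + S.realPrimarySum x y) : ℝ) : ℂ) := by
      unfold CFTData.reducedZ
      rw [primarySum_ofReal]
      push_cast
      rfl
    rw [h, Complex.norm_real, Real.norm_of_nonneg]
    have h1 : Real.exp (-x) ≤ 1 := Real.exp_le_one_iff.2 (by linarith)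
    have h2 : Real.exp (-y) ≤ 1 := Real.exp_le_one_iff.2 (by linarith)
    have h3 := realPrimarySum_nonneg (S := S) x y
    have h4 := mul_nonneg (sub_nonneg.2 h1) (sub_nonneg.2 h2)
    positivity
  rw [← key a b ha hb, ← key _ _ (by positivity) (by positivity)]
  have h := hS.reducedZ_inversion (βL := (a : ℂ)) (βR := (b : ℂ)) (by simpa) (by simpa)
  rw [h, norm_mul, Complex.norm_four_pi_sq_div_cpow, norm_mul, Complex.norm_real,
    Complex.norm_real, Real.norm_of_nonneg ha.le, Real.norm_of_nonneg hb.le]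
  push_cast
  rfl

/-- For `a, b ≤ 2π` the dual temperatures are at least `2π`, so the dual primary sum is at most its
value at the self-dual point. -/
theorem realPrimarySum_le (hS : S.IsModularCFT) {a b : ℝ} (ha : 0 < a) (hb : 0 < b)
    (ha' : a ≤ 2 * π) (hb' : b ≤ 2 * π) :
    S.realPrimarySum a b ≤ (1 + S.realPrimarySum (2 * π) (2 * π)) *
      (√(4 * π ^ 2 / (a * b)) * Real.exp (S.A * (4 * π ^ 2 / a + 4 * π ^ 2 / b))) := by
  have h := hS.real_inversion ha hb
  have hpi := Real.pi_pos
  have hA := hS.A_pos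
  have h1 : Real.exp (-a) ≤ 1 := Real.exp_le_one_iff.2 (by linarith)
  have h2 : Real.exp (-b) ≤ 1 := Real.exp_le_one_iff.2 (by linarith)
  have h3 := mul_nonneg (sub_nonneg.2 h1) (sub_nonneg.2 h2)
  have h4 := realPrimarySum_nonneg (S := S) a b
  have hx : 2 * π ≤ 4 * π ^ 2 / a := by rw [le_div_iff₀ ha]; nlinarith
  have hy : 2 * π ≤ 4 * π ^ 2 / b := by rw [le_div_iff₀ hb]; nlinarith
  have h5 := hS.realPrimarySum_anti (by positivity) hx (by positivity) hy
  have h6 : 1 ≤ Real.exp (S.A * (a + b)) := Real.one_le_exp (by positivity)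
  have h7 : (1 - Real.exp (-(4 * π ^ 2 / a))) * (1 - Real.exp (-(4 * π ^ 2 / b))) ≤ 1 := by
    have e1 : Real.exp (-(4 * π ^ 2 / a)) ≤ 1 :=
      Real.exp_le_one_iff.2 (by rw [neg_nonpos]; positivity)
    have e2 := Real.exp_pos (-(4 * π ^ 2 / a))
    have e3 : Real.exp (-(4 * π ^ 2 / b)) ≤ 1 :=
      Real.exp_le_one_iff.2 (by rw [neg_nonpos]; positivity)
    have e4 := Real.exp_pos (-(4 * π ^ 2 / b))
    nlinarith
  calc S.realPrimarySum a b ≤ Real.exp (S.A * (a + b)) *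
        ((1 - Real.exp (-a)) * (1 - Real.exp (-b)) + S.realPrimarySum a b) := by nlinarith
    _ = _ := h
    _ ≤ √(4 * π ^ 2 / (a * b)) * (Real.exp (S.A * (4 * π ^ 2 / a + 4 * π ^ 2 / b)) *
        (1 + S.realPrimarySum (2 * π) (2 * π))) := by gcongr
    _ = _ := by ring

-- Compare the two sides of S-invariance at `(x, y)` with `x` large and `y` small. The dual vacuum
-- gives a lower bound of order `√u e^{Au}/x²`, where `u = 4π²/y`; on the direct side every primary
-- carries `e^{-Tgap x}` against the prefactor `e^{Ax}`.
set_option maxHeartbeats 400000 in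
theorem one_le_mul_sq_mul_exp_neg_gap (hS : S.IsModularCFT) : ∃ K : ℝ, ∀ x : ℝ, 1 ≤ x →
    1 ≤ K * (x ^ (2 : ℝ) * Real.exp (-(S.Tgap - S.A) * x)) := by
  have hpi := Real.pi_gt_three
  have hA := hS.A_pos
  have hT := hS.Tgap_pos
  set C := 1 + S.realPrimarySum (2 * π) (2 * π) with hC
  have hC0 : 0 ≤ C := by have := realPrimarySum_nonneg (S := S) (2 * π) (2 * π); positivity
  refine ⟨4 * (Real.exp (4 * π ^ 2 * S.A) *
    (1 + C * Real.exp (4 * π ^ 2 * S.A + S.Tgap))), fun x hx => ?_⟩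
  have hx0 : 0 < x := by linarith
  -- With this `u`, `e^{Au} e^{-Tgap x} = e^{2πA} ≥ 1`. Hence the direct vacuum, which has no gap
  -- factor, obeys the same bound as the primaries, and `√u e^{Au}` cancels at the end.
  set u : ℝ := 2 * π + S.Tgap * x / S.A with hu
  have hu1 : 2 * π ≤ u := by
    rw [hu, le_add_iff_nonneg_right]
    positivity
  have hu0 : 0 < u := by linarith
  set y : ℝ := 4 * π ^ 2 / u with hy
  have hy0 : 0 < y := by positivity
  have hyu : 4 * π ^ 2 / y = u := by rw [hy]; field_simp
  have hy1 : y ≤ 2 * π := by rw [hy, div_le_iff₀ hu0]; nlinarith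
  have hup := hS.realPrimarySum_le one_pos hy0 (by linarith) hy1
  have hgap := hS.realPrimarySum_le_left one_pos hx hy0
  have hinv := hS.real_inversion hx0 hy0
  rw [hyu] at hinv hup
  set v : ℝ := 4 * π ^ 2 / x with hv
  have hv0 : 0 < v := by positivity
  have hPv := realPrimarySum_nonneg (S := S) v u
  have hs1 : √(4 * π ^ 2 / (1 * y)) = √u := by rw [one_mul, hyu]
  have hs2 : √(4 * π ^ 2 / (x * y)) = √u / √x := by
    rw [mul_comm x y, ← div_div, hyu, Real.sqrt_div hu0.le]
  rw [hs1] at hup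
  rw [hs2] at hinv
  have hev : 1 / (2 * x) ≤ 1 - Real.exp (-v) := by
    refine le_trans ?_ (Real.div_one_add_le_one_sub_exp_neg hv0.le)
    have e2 : v / (1 + v) = 4 * π ^ 2 / (x + 4 * π ^ 2) := by
      rw [hv]
      field_simp
    rw [e2, div_le_div_iff₀ (by positivity) (by positivity)]
    have hp2 : 1 ≤ π ^ 2 := by nlinarith
    nlinarith [mul_nonneg (sub_nonneg.2 hp2) (sub_nonneg.2 hx)]
  have heu : 1 / 2 ≤ 1 - Real.exp (-u) := by
    refine le_trans ?_ (Real.div_one_add_le_one_sub_exp_neg hu0.le)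
    rw [div_le_div_iff₀ (by positivity) (by positivity)]
    linarith
  have hex : Real.exp (-x) ≤ 1 := Real.exp_le_one_iff.2 (by linarith)
  have hey : Real.exp (-y) ≤ 1 := Real.exp_le_one_iff.2 (by linarith)
  have hvac : (1 - Real.exp (-x)) * (1 - Real.exp (-y)) ≤ 1 :=
    mul_le_one₀ (by linarith [Real.exp_pos (-x)]) (by linarith)
      (by linarith [Real.exp_pos (-y)])
  have hsu : 1 ≤ √u := Real.one_le_sqrt.2 (by linarith)
  have hsx : √x ≤ x := Real.sqrt_le_self_of_one_le hx
  have hsx0 : 0 < √x := Real.sqrt_pos.2 hx0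
  have hAy : Real.exp (S.A * y) ≤ Real.exp (4 * π ^ 2 * S.A) := by
    apply Real.exp_le_exp.2
    have : y ≤ 4 * π ^ 2 := by
      rw [hy]
      exact div_le_self (by positivity) (by linarith)
    rw [mul_comm]
    gcongr
  have hlow : √u / x * (Real.exp (S.A * u) * (1 / (2 * x) * (1 / 2))) ≤
      √u / √x * (Real.exp (S.A * (v + u)) *
        ((1 - Real.exp (-v)) * (1 - Real.exp (-u)) + S.realPrimarySum v u)) := by
    have e1 : Real.exp (S.A * u) ≤ Real.exp (S.A * (v + u)) := by
      have : u ≤ v + u := by linarith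
      gcongr
    have e2 : 1 / (2 * x) * (1 / 2) ≤
        (1 - Real.exp (-v)) * (1 - Real.exp (-u)) + S.realPrimarySum v u := by
      have : 1 / (2 * x) * (1 / 2) ≤ (1 - Real.exp (-v)) * (1 - Real.exp (-u)) :=
        mul_le_mul hev heu (by norm_num) (le_trans (by positivity) hev)
      linarith
    gcongr
  have hhigh : Real.exp (S.A * (x + y)) *
      ((1 - Real.exp (-x)) * (1 - Real.exp (-y)) + S.realPrimarySum x y) ≤
      Real.exp (S.A * x) * Real.exp (4 * π ^ 2 * S.A) * (√u * Real.exp (S.A * u) *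
        (Real.exp (-S.Tgap * x) * (1 + C * Real.exp (4 * π ^ 2 * S.A + S.Tgap)))) := by
    have e1 : Real.exp (S.A * (x + y)) ≤ Real.exp (S.A * x) * Real.exp (4 * π ^ 2 * S.A) := by
      rw [mul_add, Real.exp_add]
      gcongr
    have e2 : 1 ≤ √u * Real.exp (S.A * u) * Real.exp (-S.Tgap * x) := by
      have : 1 ≤ Real.exp (S.A * u) * Real.exp (-S.Tgap * x) := by
        rw [← Real.exp_add]
        apply Real.one_le_exp
        have : S.A * u = 2 * π * S.A + S.Tgap * x := by rw [hu]; field_simp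
        rw [this]
        have : 0 ≤ 2 * π * S.A := by positivity
        linarith
      rw [mul_assoc]
      exact one_le_mul_of_one_le_of_one_le hsu this
    have e3 : S.realPrimarySum x y ≤ √u * Real.exp (S.A * u) * Real.exp (-S.Tgap * x) *
        (C * Real.exp (4 * π ^ 2 * S.A + S.Tgap)) := by
      calc S.realPrimarySum x y ≤ Real.exp (-S.Tgap * (x - 1)) * S.realPrimarySum 1 y := hgap
        _ ≤ Real.exp (-S.Tgap * (x - 1)) *
          (C * (√u * Real.exp (S.A * (4 * π ^ 2 / 1 + u)))) := by gcongr
        _ = C * √u * (Real.exp (-S.Tgap * (x - 1)) * Real.exp (S.A * (4 * π ^ 2 / 1 + u))) := by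
          ring
        _ = C * √u * (Real.exp (S.A * u) * Real.exp (-S.Tgap * x) *
          Real.exp (4 * π ^ 2 * S.A + S.Tgap)) := by
          rw [← Real.exp_add, ← Real.exp_add, ← Real.exp_add]
          congr 2
          ring
        _ = _ := by ring
    calc _ ≤ Real.exp (S.A * x) * Real.exp (4 * π ^ 2 * S.A) *
        (√u * Real.exp (S.A * u) * Real.exp (-S.Tgap * x) +
          √u * Real.exp (S.A * u) * Real.exp (-S.Tgap * x) *
        (C * Real.exp (4 * π ^ 2 * S.A + S.Tgap))) := by
          have h0 : 0 ≤ (1 - Real.exp (-x)) * (1 - Real.exp (-y)) + S.realPrimarySum x y :=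
            add_nonneg (mul_nonneg (by linarith) (by linarith)) (realPrimarySum_nonneg (S := S) x y)
          have := hvac.trans e2
          gcongr
      _ = _ := by ring
  have hfin := (hlow.trans_eq hinv.symm).trans hhigh
  have e1 : √u / x * (Real.exp (S.A * u) * (1 / (2 * x) * (1 / 2))) =
      (√u * Real.exp (S.A * u)) * (1 / (4 * x ^ 2)) := by
    field_simp
    norm_num
  have e2 : Real.exp (-(S.Tgap - S.A) * x) = Real.exp (S.A * x) * Real.exp (-S.Tgap * x) := by
    rw [← Real.exp_add]
    congr 1
    ring
  have hpos : 0 < √u * Real.exp (S.A * u) := by positivity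
  have hfin2 : 1 / (4 * x ^ 2) ≤ Real.exp (S.A * x) * Real.exp (4 * π ^ 2 * S.A) *
      (Real.exp (-S.Tgap * x) * (1 + C * Real.exp (4 * π ^ 2 * S.A + S.Tgap))) := by
    refine le_of_mul_le_mul_left ?_ hpos
    rw [← e1]
    refine hfin.trans_eq ?_
    ring
  rw [div_le_iff₀ (by positivity)] at hfin2
  rw [e2, Real.rpow_two]
  refine hfin2.trans_eq ?_
  ring

/-- Otherwise `x² e^{-(Tgap - A)x}` would tend to zero while staying bounded below. -/
theorem Tgap_le_A (hS : S.IsModularCFT) : S.Tgap ≤ S.A := by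
  by_contra! h
  obtain ⟨K, hK⟩ := hS.one_le_mul_sq_mul_exp_neg_gap
  have h1 := (tendsto_rpow_mul_exp_neg_mul_atTop_nhds_zero 2 (S.Tgap - S.A)
    (sub_pos.2 h)).const_mul K
  rw [mul_zero] at h1
  have h2 := ge_of_tendsto h1 ((eventually_ge_atTop 1).mono hK)
  linarith

/-- Here `b = 4π²α/(α² + t²)` is the real part of `4π²/z` for `z = α + it`. The left side is the
dual primary contribution; compared with the peak `e^{4π²A/α}` of the dual vacuum it gains
`e^{-κ/α}`, uniformly in `t`. -/
theorem exp_mul_realPrimarySum_le (hS : S.IsModularCFT) : ∃ C K κ : ℝ, 0 < C ∧ 0 < K ∧ 0 < κ ∧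
    ∀ α t a : ℝ, 0 < α → α ≤ 1 → |t| ≤ π → 0 < a → a ≤ 1 →
      Real.exp (S.A * (4 * π ^ 2 * α / (α ^ 2 + t ^ 2))) *
        S.realPrimarySum a (4 * π ^ 2 * α / (α ^ 2 + t ^ 2)) ≤
      C * Real.exp (K / a) * α⁻¹ * Real.exp (4 * π ^ 2 * S.A / α - κ / α) := by
  have hpi := Real.pi_gt_three
  have hA := hS.A_pos
  have hT := hS.Tgap_pos
  set C₀ := 1 + S.realPrimarySum (2 * π) (2 * π) with hC₀
  have hC : 0 < C₀ := by have := realPrimarySum_nonneg (S := S) (2 * π) (2 * π); positivity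
  refine ⟨C₀ * (1 + π ^ 2) * Real.exp (2 * π * S.A + S.A + 2 * π * S.Tgap),
    2 * π + 4 * π ^ 2 * S.A, min (4 * π ^ 2 * S.Tgap) (3 * π ^ 2 * S.A), by positivity,
    by positivity, by positivity, fun α t a hα hα1 ht ha ha1 => ?_⟩
  have hα' : 1 ≤ α⁻¹ := (one_le_inv₀ hα).2 hα1
  have hden : 0 < α ^ 2 + t ^ 2 := by positivity
  set b := 4 * π ^ 2 * α / (α ^ 2 + t ^ 2) with hb
  have hb0 : 0 < b := by positivity
  set κ := min (4 * π ^ 2 * S.Tgap) (3 * π ^ 2 * S.A) with hκ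
  have hκ1 : κ ≤ 4 * π ^ 2 * S.Tgap := min_le_left _ _
  have hκ2 : κ ≤ 3 * π ^ 2 * S.A := min_le_right _ _
  have ha2 : a ≤ 2 * π := by linarith
  have hainv : 1 ≤ 1 / a := by rw [le_div_iff₀ ha]; linarith
  -- For `b ≥ 2π` the gap leaves `e^{(A - Tgap)b}` with `b ≤ 4π²/α`, and `Tgap ≤ A` makes this
  -- largest at the peak: the gain is `4π²Tgap/α`. For `b ≤ 2π` invert once more: `4π²/b ≤ 1 + π²/α`
  -- because `|t| ≤ π`, so the gain is `3π²A/α`.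
  rcases le_total (2 * π) b with hcase | hcase
  · have h1 := hS.realPrimarySum_le_right ha (by positivity) hcase
    have h2 := hS.realPrimarySum_le ha (by positivity) ha2 (le_refl (2 * π))
    have e1 : √(4 * π ^ 2 / (a * (2 * π))) ≤ Real.exp (2 * π / a) := by
      have : 4 * π ^ 2 / (a * (2 * π)) = 2 * π / a := by field_simp; norm_num
      rw [this]
      refine (Real.sqrt_le_self_of_one_le ?_).trans (Real.le_exp_self _)
      rw [le_div_iff₀ ha]
      linarith
    have hbα : b ≤ 4 * π ^ 2 / α := by
      rw [hb, div_le_div_iff₀ hden hα]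
      have : 0 ≤ π ^ 2 * t ^ 2 := by positivity
      nlinarith
    have hTA := hS.Tgap_le_A
    calc Real.exp (S.A * b) * S.realPrimarySum a b
        ≤ Real.exp (S.A * b) * (Real.exp (-S.Tgap * (b - 2 * π)) * (C₀ *
          (Real.exp (2 * π / a) * Real.exp (S.A * (4 * π ^ 2 / a + 4 * π ^ 2 / (2 * π)))))) := by
          gcongr
          refine h1.trans ?_
          gcongr
          refine h2.trans ?_
          gcongr
      _ = C₀ * Real.exp ((2 * π + 4 * π ^ 2 * S.A) / a) *
          Real.exp ((S.A - S.Tgap) * b + 2 * π * S.A + 2 * π * S.Tgap) := by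
          rw [show Real.exp (S.A * b) * (Real.exp (-S.Tgap * (b - 2 * π)) * (C₀ *
            (Real.exp (2 * π / a) * Real.exp (S.A * (4 * π ^ 2 / a + 4 * π ^ 2 / (2 * π)))))) =
            C₀ * (Real.exp (S.A * b) * Real.exp (-S.Tgap * (b - 2 * π)) *
            Real.exp (2 * π / a) * Real.exp (S.A * (4 * π ^ 2 / a + 4 * π ^ 2 / (2 * π)))) by ring,
            mul_assoc C₀, ← Real.exp_add, ← Real.exp_add, ← Real.exp_add, ← Real.exp_add]
          congr 2
          field_simp
          ring
      _ ≤ C₀ * Real.exp ((2 * π + 4 * π ^ 2 * S.A) / a) *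
          (((1 + π ^ 2) * α⁻¹) * Real.exp ((4 * π ^ 2 * S.A / α - κ / α) +
            (2 * π * S.A + S.A + 2 * π * S.Tgap))) := by
          gcongr
          have e2 : (S.A - S.Tgap) * b ≤ 4 * π ^ 2 * S.A / α - κ / α := by
            calc (S.A - S.Tgap) * b ≤ (S.A - S.Tgap) * (4 * π ^ 2 / α) := by
                  have := sub_nonneg.2 hTA
                  gcongr
              _ = 4 * π ^ 2 * S.A / α - 4 * π ^ 2 * S.Tgap / α := by ring
              _ ≤ _ := by gcongr
          have e3 : Real.exp ((S.A - S.Tgap) * b + 2 * π * S.A + 2 * π * S.Tgap) ≤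
              Real.exp ((4 * π ^ 2 * S.A / α - κ / α) +
            (2 * π * S.A + S.A + 2 * π * S.Tgap)) := Real.exp_le_exp.2 (by linarith)
          refine e3.trans (le_mul_of_one_le_left (Real.exp_pos _).le ?_)
          nlinarith
      _ = _ := by
          rw [Real.exp_add]
          ring
  · have h2 := hS.realPrimarySum_le ha hb0 ha2 hcase
    have hbinv : 4 * π ^ 2 / b = (α ^ 2 + t ^ 2) / α := by
      rw [hb]
      field_simp
    have ht2 : t ^ 2 ≤ π ^ 2 := by
      rw [← sq_abs]
      gcongr
    have hb1 : 4 * π ^ 2 / b ≤ (1 + π ^ 2) * α⁻¹ := by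
      rw [hbinv, div_eq_mul_inv]
      gcongr
      nlinarith
    have hb2 : 4 * π ^ 2 / b ≤ 1 + π ^ 2 / α := by
      rw [hbinv, add_div]
      gcongr
      rw [div_le_one hα]
      nlinarith
    have hb3 : 1 ≤ 4 * π ^ 2 / b := by
      rw [le_div_iff₀ hb0]
      nlinarith
    have e1 : √(4 * π ^ 2 / (a * b)) ≤ Real.exp (1 / a) * ((1 + π ^ 2) * α⁻¹) := by
      have e0 : 4 * π ^ 2 / (a * b) = 1 / a * (4 * π ^ 2 / b) := by field_simp
      rw [e0]
      refine (Real.sqrt_le_self_of_one_le (by nlinarith)).trans ?_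
      have := Real.le_exp_self (1 / a)
      gcongr
    have e2 : Real.exp (S.A * (4 * π ^ 2 / a + 4 * π ^ 2 / b)) ≤
        Real.exp (4 * π ^ 2 * S.A / a + (S.A + (4 * π ^ 2 * S.A / α - κ / α))) := by
      apply Real.exp_le_exp.2
      have : S.A * (4 * π ^ 2 / b) ≤ S.A * (1 + π ^ 2 / α) := by gcongr
      have h3 : S.A * (1 + π ^ 2 / α) = S.A + (4 * π ^ 2 * S.A / α - 3 * π ^ 2 * S.A / α) := by
        ring
      have h4 : κ / α ≤ 3 * π ^ 2 * S.A / α := by gcongr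
      have h5 : S.A * (4 * π ^ 2 / a) = 4 * π ^ 2 * S.A / a := by ring
      rw [mul_add]
      linarith
    have e3 : Real.exp (S.A * b) ≤ Real.exp (2 * π * S.A) :=
      Real.exp_le_exp.2 (by nlinarith)
    calc Real.exp (S.A * b) * S.realPrimarySum a b
        ≤ Real.exp (2 * π * S.A) * (C₀ * (Real.exp (1 / a) * ((1 + π ^ 2) * α⁻¹) *
          Real.exp (4 * π ^ 2 * S.A / a + (S.A + (4 * π ^ 2 * S.A / α - κ / α))))) := by
          have := realPrimarySum_nonneg (S := S) a b
          gcongr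
          refine h2.trans ?_
          gcongr
      _ = C₀ * (1 + π ^ 2) * Real.exp (2 * π * S.A + S.A) * Real.exp ((1 + 4 * π ^ 2 * S.A) / a)
          * α⁻¹ * Real.exp (4 * π ^ 2 * S.A / α - κ / α) := by
          rw [add_div, Real.exp_add, Real.exp_add, Real.exp_add, Real.exp_add]
          ring
      _ ≤ _ := by
          have e4 : Real.exp (2 * π * S.A + S.A) ≤
              Real.exp (2 * π * S.A + S.A + 2 * π * S.Tgap) :=
            Real.exp_le_exp.2 (by linarith [mul_pos Real.pi_pos hT])
          have e5 : (1 : ℝ) ≤ 2 * π := by linarith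
          gcongr

end CFTData.IsModularCFT

/-! ### The vacuum term: decay, contours and support -/

theorem Complex.norm_one_sub_exp_neg_le {u : ℂ} (hu : 0 ≤ u.re) :
    ‖1 - Complex.exp (-u)‖ ≤ 2 := by
  refine (norm_sub_le _ _).trans ?_
  rw [norm_one, Complex.norm_exp]
  have : Real.exp (-u).re ≤ 1 := Real.exp_le_one_iff.2 (by simpa using hu)
  linarith

theorem Complex.norm_one_sub_exp_neg_le_mul_norm {u : ℂ} (hu : 0 ≤ u.re) :
    ‖1 - Complex.exp (-u)‖ ≤ 2 * ‖u‖ := by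
  rcases le_total ‖u‖ 1 with h | h
  · rw [norm_sub_rev]
    simpa using Complex.norm_exp_sub_one_le (x := -u) (by simpa using h)
  · linarith [Complex.norm_one_sub_exp_neg_le hu]

theorem Complex.re_le_of_div_of_pos_le {r a : ℝ} (hr : 0 ≤ r) (ha : 0 < a) {z : ℂ}
    (hz : a ≤ ‖z‖) : ((r : ℂ) / z).re ≤ r / a := by
  refine (Complex.re_le_norm _).trans ?_
  rw [norm_div, Complex.norm_real, Real.norm_of_nonneg hr]
  gcongr

/-- Inverse Laplace transforms of functions of decay `-3/2` in a half plane vanish. -/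
theorem integral_vertical_eq_zero {q : ℂ → ℂ} {β C : ℝ} (hβ : 0 < β)
    (hd : ∀ w : ℂ, β ≤ w.re → DifferentiableAt ℂ q w)
    (hq : ∀ w : ℂ, β ≤ w.re → ‖q w‖ ≤ C * (1 + ‖w‖) ^ (-(3 / 2) : ℝ))
    (hi : Integrable fun s : ℝ => q ((β : ℂ) + (s : ℂ) * Complex.I)) :
    ∫ s : ℝ, q ((β : ℂ) + (s : ℂ) * Complex.I) = 0 := by
  have hC : 0 ≤ C := by
    have h1 := (norm_nonneg _).trans (hq (β : ℂ) (by simp))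
    exact nonneg_of_mul_nonneg_left h1 (by positivity)
  have hlim := intervalIntegral_tendsto_integral hi
    (tendsto_neg_atTop_atBot.comp tendsto_id) tendsto_id
  have hb : ∀ T : ℝ, 0 < T → ∀ w : ℂ, β ≤ w.re → T ≤ ‖w‖ → ‖q w‖ ≤ C * T ^ (-(3 / 2) : ℝ) := by
    intro T hT w hw hTw
    refine (hq w hw).trans ?_
    have := Real.rpow_le_rpow_of_nonpos hT (by linarith : T ≤ 1 + ‖w‖)
      (by norm_num : (-(3 / 2) : ℝ) ≤ 0)
    gcongr
  have hbound : ∀ᶠ T : ℝ in atTop,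
      ‖∫ s in (-T)..T, q ((β : ℂ) + (s : ℂ) * Complex.I)‖ ≤ 4 * C * T ^ (-(1 / 2) : ℝ) := by
    filter_upwards [eventually_gt_atTop 0] with T hT
    -- Cauchy on the rectangle `[β, β + T] × [-T, T]`: its other three sides have length `O(T)` and
    -- the integrand there is `O(T^{-3/2})`.
    have hrect := Complex.integral_boundary_rect_eq_zero_of_differentiableOn q
      ⟨β, -T⟩ ⟨β + T, T⟩ (by
        intro w hw
        refine (hd w ?_).differentiableWithinAt
        have := hw.1
        rw [mem_preimage, uIcc_of_le (by simp [hT.le])] at this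
        exact this.1)
    simp only at hrect
    have e1 : ‖∫ x : ℝ in β..(β + T), q (x + (((-T : ℝ)) : ℂ) * Complex.I)‖ ≤
        C * T ^ (-(3 / 2) : ℝ) * |β + T - β| := by
      refine intervalIntegral.norm_integral_le_of_norm_le_const fun x hx => ?_
      rw [uIoc_of_le (by linarith)] at hx
      refine hb T hT _ (by simpa using hx.1.le) ?_
      refine le_trans ?_ (Complex.abs_im_le_norm _)
      simp [abs_of_pos hT]
    have e2 : ‖∫ x : ℝ in β..(β + T), q (x + (T : ℂ) * Complex.I)‖ ≤
        C * T ^ (-(3 / 2) : ℝ) * |β + T - β| := by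
      refine intervalIntegral.norm_integral_le_of_norm_le_const fun x hx => ?_
      rw [uIoc_of_le (by linarith)] at hx
      refine hb T hT _ (by simpa using hx.1.le) ?_
      refine le_trans ?_ (Complex.abs_im_le_norm _)
      simp [abs_of_pos hT]
    have e3 : ‖∫ y : ℝ in (-T)..T, q (((β + T : ℝ) : ℂ) + (y : ℂ) * Complex.I)‖ ≤
        C * T ^ (-(3 / 2) : ℝ) * |T - -T| := by
      refine intervalIntegral.norm_integral_le_of_norm_le_const fun x hx => ?_
      refine hb T hT _ (by simp [hT.le]) ?_
      refine le_trans ?_ (Complex.abs_re_le_norm _)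
      simp only [Complex.add_re, Complex.ofReal_re, Complex.mul_re, Complex.I_re, mul_zero,
        Complex.ofReal_im, Complex.I_im, zero_mul, sub_zero, add_zero]
      exact le_trans (by linarith) (le_abs_self _)
    have e4 : T ^ (-(3 / 2) : ℝ) * T = T ^ (-(1 / 2) : ℝ) := by
      nth_rewrite 2 [← Real.rpow_one T]
      rw [← Real.rpow_add hT]
      norm_num
    have e5 : |β + T - β| = T := by rw [add_sub_cancel_left, abs_of_pos hT]
    have e6 : |T - -T| = 2 * T := by rw [sub_neg_eq_add, ← two_mul, abs_of_pos (by positivity)]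
    rw [e5, mul_assoc, e4] at e1 e2
    rw [e6, show C * T ^ (-(3 / 2) : ℝ) * (2 * T) = 2 * (C * (T ^ (-(3 / 2) : ℝ) * T)) by ring,
      e4] at e3
    have e7 : Complex.I • ∫ y : ℝ in (-T)..T, q ((β : ℂ) + (y : ℂ) * Complex.I) =
        (∫ x : ℝ in β..(β + T), q (x + (((-T : ℝ)) : ℂ) * Complex.I)) -
        (∫ x : ℝ in β..(β + T), q (x + (T : ℂ) * Complex.I)) +
        Complex.I • ∫ y : ℝ in (-T)..T, q (((β + T : ℝ) : ℂ) + (y : ℂ) * Complex.I) :=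
      (sub_eq_zero.1 hrect).symm
    have e8 := congrArg norm e7
    rw [norm_smul, Complex.norm_I, one_mul] at e8
    rw [e8]
    refine (norm_add_le _ _).trans ((add_le_add (norm_sub_le _ _) le_rfl).trans ?_)
    rw [norm_smul, Complex.norm_I, one_mul]
    linarith
  have hzero : Tendsto (fun T : ℝ => ∫ s in (-T)..T, q ((β : ℂ) + (s : ℂ) * Complex.I))
      atTop (nhds 0) := by
    refine squeeze_zero_norm' hbound ?_
    simpa using (tendsto_rpow_neg_atTop (by norm_num : (0 : ℝ) < 1 / 2)).const_mul (4 * C)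
  exact tendsto_nhds_unique hlim hzero

theorem continuous_vacIntegrand {X : Type*} [TopologicalSpace X] (A : ℝ) (J : ℤ)
    {βL z : X → ℂ} (hβ : Continuous βL) (hz : Continuous z) (hz0 : ∀ x, 0 < (z x).re)
    (hw0 : ∀ x, 0 < (βL x - z x).re) : Continuous fun x => vacIntegrand A J (βL x) (z x) := by
  have h1 : ∀ x, z x ≠ 0 := fun x => Complex.ne_zero_of_re_pos (hz0 x)
  have h2 : ∀ x, βL x - z x ≠ 0 := fun x => Complex.ne_zero_of_re_pos (hw0 x)
  have h3 : ∀ x, z x * (βL x - z x) ≠ 0 := fun x => mul_ne_zero (h1 x) (h2 x)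
  have h4 : Continuous fun x => (4 * (π : ℂ) ^ 2 / (z x * (βL x - z x))) ^ (1 / 2 : ℂ) := by
    refine Continuous.cpow (by fun_prop (disch := assumption)) continuous_const fun x => ?_
    exact Complex.four_pi_sq_div_mem_slitPlane
      (Complex.mul_mem_slitPlane_of_re_pos (hz0 x) (hw0 x))
  unfold vacIntegrand
  fun_prop (disch := assumption)

theorem differentiableAt_vacIntegrand (A : ℝ) (J : ℤ) {βL z : ℂ} (hz0 : 0 < z.re)
    (hw0 : 0 < (βL - z).re) : DifferentiableAt ℂ (fun b => vacIntegrand A J b z) βL := by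
  have h1 : z ≠ 0 := Complex.ne_zero_of_re_pos hz0
  have h2 : βL - z ≠ 0 := Complex.ne_zero_of_re_pos hw0
  have h3 : z * (βL - z) ≠ 0 := mul_ne_zero h1 h2
  have h4 : DifferentiableAt ℂ (fun b => (4 * (π : ℂ) ^ 2 / (z * (b - z))) ^ (1 / 2 : ℂ)) βL := by
    refine DifferentiableAt.cpow (by fun_prop (disch := assumption))
      (differentiableAt_const _) ?_
    exact Complex.four_pi_sq_div_mem_slitPlane (Complex.mul_mem_slitPlane_of_re_pos hz0 hw0)
  unfold vacIntegrand
  fun_prop (disch := assumption)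

/-- The decay `-3/2` in `β_L` is `-1/2` from the square root and `-1` from `1 - e^{-4π²/(β_L - z)}`;
it is what makes the inverse Laplace integral absolutely convergent. -/
theorem norm_vacIntegrand_le {A β : ℝ} (hA : 0 < A) (hβ : 0 < β) : ∃ C : ℝ, 0 < C ∧
    ∀ (α t : ℝ) (J : ℤ) (βL : ℂ), 0 < α → α ≤ 1 → α ≤ β / 2 → |t| ≤ π →
      α * J = 4 * π ^ 2 * A / α → β ≤ βL.re →
      ‖vacIntegrand A J βL ((α : ℂ) + (t : ℂ) * Complex.I)‖ ≤
        C * (α⁻¹ * Real.exp (2 * (4 * π ^ 2 * A / α))) * (1 + ‖βL‖) ^ (-(3 / 2) : ℝ) := by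
  have hpi := Real.pi_pos
  -- Chosen so that `1 + ‖β_L‖ ≤ K‖β_L - z‖`, using `‖z‖ ≤ 1 + π` and `‖β_L - z‖ ≥ β/2`.
  set K : ℝ := 1 + (2 + π) / (β / 2) with hK
  have hK0 : 0 < K := by positivity
  refine ⟨2 * π * Real.exp (4 * π ^ 2 * A / (β / 2)) * (2 * (4 * π ^ 2)) * 2 * K ^ (3 / 2 : ℝ),
    by positivity, fun α t J βL hα hα1 hαβ ht hJ hβL => ?_⟩
  set z : ℂ := (α : ℂ) + (t : ℂ) * Complex.I with hz
  have hzre : z.re = α := by simp [hz]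
  have hzα : α ≤ ‖z‖ := by
    rw [← hzre]
    exact Complex.re_le_norm z
  have hzn : ‖z‖ ≤ 1 + π := by
    rw [hz]
    refine (norm_add_le _ _).trans ?_
    rw [norm_mul, Complex.norm_I, Complex.norm_real, Complex.norm_real, mul_one,
      Real.norm_of_nonneg hα.le, Real.norm_eq_abs]
    linarith
  set w : ℂ := βL - z with hw
  have hwre : β / 2 ≤ w.re := by
    rw [hw, Complex.sub_re, hzre]
    linarith
  have hwn : β / 2 ≤ ‖w‖ := hwre.trans (Complex.re_le_norm w)
  have hw0 : 0 < ‖w‖ := by linarith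
  have hKw : 1 + ‖βL‖ ≤ K * ‖w‖ := by
    have h1 : ‖βL‖ ≤ ‖w‖ + ‖z‖ := by
      have : βL = w + z := by rw [hw]; ring
      rw [this]
      exact norm_add_le _ _
    have h2 : (2 + π) / (β / 2) * ‖w‖ ≥ 2 + π := by
      rw [ge_iff_le, div_mul_eq_mul_div, le_div_iff₀ (by positivity)]
      gcongr
    rw [hK, add_mul, one_mul]
    linarith
  have hdecay : ‖w‖ ^ (-(3 / 2) : ℝ) ≤ K ^ (3 / 2 : ℝ) * (1 + ‖βL‖) ^ (-(3 / 2) : ℝ) := by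
    have h1 := Real.rpow_le_rpow_of_nonpos (by positivity) hKw
      (by norm_num : (-(3 / 2) : ℝ) ≤ 0)
    rw [Real.mul_rpow hK0.le hw0.le, Real.rpow_neg hK0.le] at h1
    rwa [inv_mul_le_iff₀ (by positivity)] at h1
  have f1 : ‖Complex.exp (z * J)‖ = Real.exp (4 * π ^ 2 * A / α) := by
    rw [Complex.norm_exp, ← hJ]
    congr 1
    simp [hzre]
  have f2 : ‖(4 * (π : ℂ) ^ 2 / (z * w)) ^ (1 / 2 : ℂ)‖ ≤
      2 * π * α⁻¹ * ‖w‖ ^ (-(1 / 2) : ℝ) := by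
    rw [Complex.norm_four_pi_sq_div_cpow, norm_mul, Real.rpow_neg hw0.le, ← Real.sqrt_eq_rpow]
    have e1 : 4 * π ^ 2 / (‖z‖ * ‖w‖) = (2 * π) ^ 2 / ‖z‖ / ‖w‖ := by
      field_simp
      norm_num
    have hz0 : 0 < ‖z‖ := hα.trans_le hzα
    rw [e1, Real.sqrt_div (by positivity), Real.sqrt_div (by positivity),
      Real.sqrt_sq (by positivity), div_eq_mul_inv _ (√‖w‖), div_eq_mul_inv]
    have e2 : α ≤ √‖z‖ := by
      refine le_trans ?_ (Real.sqrt_le_sqrt hzα)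
      exact Real.le_sqrt_of_sq_le (by nlinarith)
    gcongr
  have f3 : ‖Complex.exp (4 * π ^ 2 * A / w + 4 * π ^ 2 * A / z)‖ ≤
      Real.exp (4 * π ^ 2 * A / (β / 2)) * Real.exp (4 * π ^ 2 * A / α) := by
    rw [Complex.norm_exp, ← Real.exp_add, Complex.add_re]
    have h1 := Complex.re_le_of_div_of_pos_le (r := 4 * π ^ 2 * A) (by positivity)
      (half_pos hβ) hwn
    have h2 := Complex.re_le_of_div_of_pos_le (r := 4 * π ^ 2 * A) (by positivity) hα hzα
    push_cast at h1 h2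
    gcongr
  have f4 : ‖1 - Complex.exp (-(4 * π ^ 2 / w))‖ ≤ 2 * (4 * π ^ 2) * ‖w‖⁻¹ := by
    refine (Complex.norm_one_sub_exp_neg_le_mul_norm
      (Complex.re_four_pi_sq_div_pos (by linarith)).le).trans_eq ?_
    rw [norm_div, norm_mul, norm_pow, Complex.norm_real, Real.norm_of_nonneg hpi.le]
    norm_num
    ring
  have f5 : ‖1 - Complex.exp (-(4 * π ^ 2 / z))‖ ≤ 2 :=
    Complex.norm_one_sub_exp_neg_le (Complex.re_four_pi_sq_div_pos (by rwa [hzre])).le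
  have f6 : ‖w‖ ^ (-(1 / 2) : ℝ) * ‖w‖⁻¹ = ‖w‖ ^ (-(3 / 2) : ℝ) := by
    rw [← Real.rpow_neg_one, ← Real.rpow_add hw0]
    norm_num
  unfold vacIntegrand
  rw [norm_mul, norm_mul, norm_mul, norm_mul, f1]
  calc _ ≤ Real.exp (4 * π ^ 2 * A / α) * (2 * π * α⁻¹ * ‖w‖ ^ (-(1 / 2) : ℝ)) *
        (Real.exp (4 * π ^ 2 * A / (β / 2)) * Real.exp (4 * π ^ 2 * A / α)) *
        (2 * (4 * π ^ 2) * ‖w‖⁻¹) * 2 := by gcongr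
    _ = 2 * π * Real.exp (4 * π ^ 2 * A / (β / 2)) * (2 * (4 * π ^ 2)) * 2 *
        (α⁻¹ * Real.exp (2 * (4 * π ^ 2 * A / α))) * (‖w‖ ^ (-(1 / 2) : ℝ) * ‖w‖⁻¹) := by
        rw [two_mul (4 * π ^ 2 * A / α), Real.exp_add]
        ring
    _ ≤ 2 * π * Real.exp (4 * π ^ 2 * A / (β / 2)) * (2 * (4 * π ^ 2)) * 2 *
        (α⁻¹ * Real.exp (2 * (4 * π ^ 2 * A / α))) *
        (K ^ (3 / 2 : ℝ) * (1 + ‖βL‖) ^ (-(3 / 2) : ℝ)) := by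
        rw [f6]
        gcongr
    _ = _ := by ring

/-- The spins large enough for the contour estimates at abscissa `β`. -/
def SmallAlpha (A β : ℝ) (J : ℤ) : Prop :=
  2 ≤ J ∧ alphaJ A J ≤ 1 ∧ alphaJ A J ≤ β / 2

theorem alphaJ_eq {A : ℝ} {J : ℤ} (hJ : 0 ≤ J) : alphaJ A J = 2 * π * √A / √J := by
  unfold alphaJ
  rw [Real.sqrt_div' _ (by exact_mod_cast hJ)]
  ring

theorem eventually_smallAlpha (A : ℝ) {β : ℝ} (hβ : 0 < β) :
    ∀ᶠ J : ℤ in atTop, SmallAlpha A β J := by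
  have h1 : Tendsto (fun J : ℤ => alphaJ A J) atTop (nhds 0) := by
    have h2 : Tendsto (fun J : ℤ => 2 * π * √(A / (J : ℝ))) atTop (nhds (2 * π * √0)) :=
      ((tendsto_const_nhds.div_atTop tendsto_intCast_atTop_atTop).sqrt).const_mul _
    simpa [alphaJ] using h2
  filter_upwards [eventually_ge_atTop 2, h1.eventually_le_const one_pos,
    h1.eventually_le_const (half_pos hβ)] with J a b c using ⟨a, b, c⟩

namespace SmallAlpha

variable {A β : ℝ} {J : ℤ}

theorem cast_pos (h : SmallAlpha A β J) : (0 : ℝ) < J := by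
  have : 0 < J := by linarith [h.1]
  exact_mod_cast this

theorem alphaJ_pos (h : SmallAlpha A β J) (hA : 0 < A) : 0 < alphaJ A J := by
  have := h.cast_pos
  unfold alphaJ
  positivity

theorem four_pi_sq_div (h : SmallAlpha A β J) (hA : 0 < A) :
    4 * π ^ 2 * A / alphaJ A J = 2 * π * √(A * J) := by
  have hJ := h.cast_pos
  rw [alphaJ_eq (by linarith [h.1]), Real.sqrt_mul hA.le]
  have h1 : 0 < √A := Real.sqrt_pos.2 hA
  have h2 : 0 < √(J : ℝ) := Real.sqrt_pos.2 hJ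
  have h3 : √A * √A = A := Real.mul_self_sqrt hA.le
  field_simp
  linear_combination -4 * h3

/-- `α` is the saddle point of `zJ + 4π²A/z`: the two terms agree there, each contributing half of
the exponent `4π√(AJ)`. -/
theorem alphaJ_mul (h : SmallAlpha A β J) (hA : 0 < A) :
    alphaJ A J * J = 4 * π ^ 2 * A / alphaJ A J := by
  have hJ := h.cast_pos
  rw [h.four_pi_sq_div hA, alphaJ_eq (by linarith [h.1]), Real.sqrt_mul hA.le]
  have h2 : 0 < √(J : ℝ) := Real.sqrt_pos.2 hJ
  have h3 : √(J : ℝ) * √J = J := Real.mul_self_sqrt hJ.le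
  nth_rewrite 2 [← h3]
  field_simp

end SmallAlpha

/-- The size of the vacuum term at spin `J`. -/
noncomputable def vacScale (A : ℝ) (J : ℤ) : ℝ :=
  (alphaJ A J)⁻¹ * Real.exp (4 * π * √(A * J))

theorem SmallAlpha.vacScale_pos {A β : ℝ} {J : ℤ} (h : SmallAlpha A β J) (hA : 0 < A) :
    0 < vacScale A J := by
  have := h.alphaJ_pos hA
  unfold vacScale
  positivity

theorem abs_le_pi_of_mem_uIoc {t : ℝ} (ht : t ∈ uIoc (-π) π) : |t| ≤ π := by
  rw [uIoc_of_le (by linarith [Real.pi_pos])] at ht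
  exact abs_le.2 ⟨ht.1.le, ht.2⟩

theorem norm_vacIntegrand_segment_le {A β : ℝ} (hA : 0 < A) (hβ : 0 < β) : ∃ C : ℝ, 0 < C ∧
    ∀ (J : ℤ) (t : ℝ) (βL : ℂ), SmallAlpha A β J → |t| ≤ π → β ≤ βL.re →
      ‖vacIntegrand A J βL ((alphaJ A J : ℂ) + (t : ℂ) * Complex.I)‖ ≤
        C * vacScale A J * (1 + ‖βL‖) ^ (-(3 / 2) : ℝ) := by
  obtain ⟨C, hC, h⟩ := norm_vacIntegrand_le hA hβ
  refine ⟨C, hC, fun J t βL hJ ht hβL => ?_⟩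
  refine (h _ t J βL (hJ.alphaJ_pos hA) hJ.2.1 hJ.2.2 ht (hJ.alphaJ_mul hA) hβL).trans_eq ?_
  rw [hJ.four_pi_sq_div hA, vacScale]
  ring_nf

theorem norm_Fvac_le {A β : ℝ} (hA : 0 < A) (hβ : 0 < β) : ∃ C : ℝ, 0 < C ∧
    ∀ (J : ℤ) (βL : ℂ), SmallAlpha A β J → β ≤ βL.re →
      ‖Fvac A βL J‖ ≤ C * vacScale A J * (1 + ‖βL‖) ^ (-(3 / 2) : ℝ) := by
  obtain ⟨C, hC, h⟩ := norm_vacIntegrand_segment_le hA hβ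
  have hpi := Real.pi_pos
  refine ⟨C, hC, fun J βL hJ hβL => ?_⟩
  unfold Fvac
  rw [intervalIntegral.integral_const_mul, norm_mul]
  have h1 := intervalIntegral.norm_integral_le_of_norm_le_const (a := -π) (b := π)
    (f := fun t : ℝ => vacIntegrand A J βL ((alphaJ A J : ℂ) + (t : ℂ) * Complex.I))
    (fun t ht => h J t βL hJ (abs_le_pi_of_mem_uIoc ht) hβL)
  have h2 : ‖(1 / (2 * π) : ℂ)‖ = 1 / (2 * π) := by
    rw [norm_div, norm_mul, Complex.norm_real, Real.norm_of_nonneg hpi.le]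
    norm_num
  have h3 : |π - -π| = 2 * π := by rw [sub_neg_eq_add, ← two_mul, abs_of_pos (by positivity)]
  rw [h2]
  rw [h3] at h1
  calc _ ≤ 1 / (2 * π) * (C * vacScale A J * (1 + ‖βL‖) ^ (-(3 / 2) : ℝ) * (2 * π)) := by
        gcongr
    _ = _ := by field_simp

theorem one_add_norm_rpow_le (β s : ℝ) :
    (1 + ‖(β : ℂ) + (s : ℂ) * Complex.I‖) ^ (-(3 / 2) : ℝ) ≤ (1 + ‖s‖) ^ (-(3 / 2) : ℝ) := by
  refine Real.rpow_le_rpow_of_nonpos (by positivity) ?_ (by norm_num)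
  have := Complex.abs_im_le_norm ((β : ℂ) + (s : ℂ) * Complex.I)
  simpa using this

theorem integrable_one_add_norm_rpow :
    Integrable fun s : ℝ => (1 + ‖s‖) ^ (-(3 / 2) : ℝ) :=
  integrable_one_add_norm (by norm_num)

section Fixed

variable {A β : ℝ} {J : ℤ}

theorem SmallAlpha.continuous_vacIntegrand (hJ : SmallAlpha A β J) (hA : 0 < A) :
    Continuous fun p : ℝ × ℝ => vacIntegrand A J ((β : ℂ) + (p.1 : ℂ) * Complex.I)
      ((alphaJ A J : ℂ) + (p.2 : ℂ) * Complex.I) := by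
  have h1 := hJ.alphaJ_pos hA
  have h2 := hJ.2.2
  refine _root_.continuous_vacIntegrand A J (by fun_prop) (by fun_prop) (fun p => ?_)
    (fun p => ?_)
  · simpa using h1
  · simp only [Complex.sub_re, Complex.add_re, Complex.ofReal_re, Complex.mul_re, Complex.I_re,
      mul_zero, Complex.ofReal_im, Complex.I_im, mul_one, sub_self, add_zero]
    linarith

theorem SmallAlpha.continuous_Fvac (hJ : SmallAlpha A β J) (hA : 0 < A) :
    Continuous fun s : ℝ => Fvac A ((β : ℂ) + (s : ℂ) * Complex.I) J := by
  unfold Fvac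
  refine intervalIntegral.continuous_parametric_intervalIntegral_of_continuous' ?_ _ _
  exact continuous_const.mul (hJ.continuous_vacIntegrand hA)

theorem SmallAlpha.integrable_Fvac (hJ : SmallAlpha A β J) (hA : 0 < A) (hβ : 0 < β) :
    Integrable fun s : ℝ => Fvac A ((β : ℂ) + (s : ℂ) * Complex.I) J := by
  obtain ⟨C, hC, h⟩ := norm_Fvac_le hA hβ
  have h0 := hJ.vacScale_pos hA
  refine (integrable_one_add_norm_rpow.const_mul (C * vacScale A J)).mono'
    (hJ.continuous_Fvac hA).aestronglyMeasurable (Eventually.of_forall fun s => ?_)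
  refine (h J _ hJ (by simp)).trans ?_
  have := one_add_norm_rpow_le β s
  gcongr

theorem norm_exp_line (β s x : ℝ) :
    ‖Complex.exp (((β : ℂ) + (s : ℂ) * Complex.I) * x)‖ = Real.exp (β * x) := by
  rw [Complex.norm_exp]
  simp

theorem SmallAlpha.integrable_rhoVacIntegrand (hJ : SmallAlpha A β J) (hA : 0 < A)
    (hβ : 0 < β) (h : ℝ) : Integrable (rhoVacIntegrand A β J h) := by
  unfold rhoVacIntegrand
  refine ((hJ.integrable_Fvac hA hβ).const_mul _).mul_bdd (c := Real.exp (β * (h - A)))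
    (by fun_prop) (Eventually.of_forall fun s => ?_)
  rw [← Complex.ofReal_sub, norm_exp_line]

theorem SmallAlpha.continuous_rhoVac (hJ : SmallAlpha A β J) (hA : 0 < A) (hβ : 0 < β) :
    Continuous (rhoVac A β J) := by
  -- The factor growing with `h` is pulled out, so that the remaining integrand is dominated
  -- independently of `h`.
  have h1 : ∀ h : ℝ, rhoVac A β J h = (1 / 2 : ℂ) * (Complex.exp (β * (h - A)) *
      ∫ s : ℝ, (1 / (2 * π) : ℂ) * Fvac A ((β : ℂ) + (s : ℂ) * Complex.I) J *
        Complex.exp ((s : ℂ) * Complex.I * (h - A))) := by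
    intro h
    unfold rhoVac rhoVacIntegrand
    congr 1
    rw [← integral_const_mul]
    congr 1
    ext s
    rw [add_mul, Complex.exp_add]
    ring
  have h2 := hJ.continuous_Fvac hA
  have h3 : Continuous fun h : ℝ =>
      ∫ s : ℝ, (1 / (2 * π) : ℂ) * Fvac A ((β : ℂ) + (s : ℂ) * Complex.I) J *
        Complex.exp ((s : ℂ) * Complex.I * (h - A)) := by
    refine continuous_of_dominated (bound := fun s =>
      ‖(1 / (2 * π) : ℂ) * Fvac A ((β : ℂ) + (s : ℂ) * Complex.I) J‖)
      (fun h => by fun_prop) (fun h => Eventually.of_forall fun s => ?_)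
      ((hJ.integrable_Fvac hA hβ).const_mul _).norm
      (Eventually.of_forall fun s => by fun_prop)
    rw [norm_mul, Complex.norm_exp]
    simp
  rw [funext h1]
  fun_prop

/-- The vacuum density vanishes below `h = A`: close the contour in the right half plane. -/
theorem SmallAlpha.rhoVac_eq_zero (hJ : SmallAlpha A β J) (hA : 0 < A) (hβ : 0 < β) {h : ℝ}
    (hh : h ≤ A) : rhoVac A β J h = 0 := by
  obtain ⟨C, hC, hb⟩ := norm_vacIntegrand_segment_le hA hβ
  have h0 := hJ.vacScale_pos hA
  have hα := hJ.alphaJ_pos hA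
  have hα2 := hJ.2.2
  set f : ℝ → ℝ → ℂ := fun s t => vacIntegrand A J ((β : ℂ) + (s : ℂ) * Complex.I)
      ((alphaJ A J : ℂ) + (t : ℂ) * Complex.I) *
      Complex.exp (((β : ℂ) + (s : ℂ) * Complex.I) * ((h : ℂ) - A)) with hf
  have hexp : ∀ w : ℂ, β ≤ w.re → ‖Complex.exp (w * ((h : ℂ) - A))‖ ≤ 1 := by
    intro w hw
    rw [Complex.norm_exp, Real.exp_le_one_iff, ← Complex.ofReal_sub, Complex.re_mul_ofReal]
    exact mul_nonpos_of_nonneg_of_nonpos (hβ.le.trans hw) (by linarith)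
  have hbound : ∀ (w : ℂ) (t : ℝ), β ≤ w.re → |t| ≤ π →
      ‖vacIntegrand A J w ((alphaJ A J : ℂ) + (t : ℂ) * Complex.I) *
        Complex.exp (w * ((h : ℂ) - A))‖ ≤
      C * vacScale A J * (1 + ‖w‖) ^ (-(3 / 2) : ℝ) := by
    intro w t hw ht
    rw [norm_mul]
    exact (mul_le_of_le_one_right (norm_nonneg _) (hexp w hw)).trans (hb J t w hJ ht hw)
  have hfc : Continuous (Function.uncurry f) := by
    have h1 := hJ.continuous_vacIntegrand hA
    have h2 : Continuous fun p : ℝ × ℝ =>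
      Complex.exp (((β : ℂ) + (p.1 : ℂ) * Complex.I) * ((h : ℂ) - A)) := by fun_prop
    exact h1.mul h2
  have hzero : ∀ t : ℝ, |t| ≤ π → ∫ s, f s t = 0 := by
    intro t ht
    refine integral_vertical_eq_zero (q := fun w =>
      vacIntegrand A J w ((alphaJ A J : ℂ) + (t : ℂ) * Complex.I) *
        Complex.exp (w * ((h : ℂ) - A))) hβ (fun w hw => ?_)
      (fun w hw => hbound w t hw ht) ?_
    · refine DifferentiableAt.mul (differentiableAt_vacIntegrand A J (by simpa using hα) ?_)
        (by fun_prop)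
      simp only [Complex.sub_re, Complex.add_re, Complex.ofReal_re, Complex.mul_re, Complex.I_re,
        mul_zero, Complex.ofReal_im, Complex.I_im, mul_one, sub_self, add_zero]
      linarith
    · refine (integrable_one_add_norm_rpow.const_mul (C * vacScale A J)).mono' ?_
        (Eventually.of_forall fun s => ?_)
      · exact (hfc.comp (by fun_prop : Continuous fun s : ℝ => (s, t))).aestronglyMeasurable
      · refine (hbound _ t (by simp) ht).trans ?_
        have := one_add_norm_rpow_le β s
        gcongr
  have hfin : IsFiniteMeasure ((volume : Measure ℝ).restrict (uIoc (-π) π)) := by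
    rw [uIoc_of_le (by linarith [Real.pi_pos])]
    infer_instance
  have hint : Integrable (Function.uncurry f)
      ((volume : Measure ℝ).prod (volume.restrict (uIoc (-π) π))) := by
    have h1 : Integrable (fun p : ℝ × ℝ => (1 + ‖p.1‖) ^ (-(3 / 2) : ℝ) * (1 : ℝ))
        ((volume : Measure ℝ).prod (volume.restrict (uIoc (-π) π))) :=
      integrable_one_add_norm_rpow.mul_prod (integrable_const (1 : ℝ))
    refine (h1.const_mul (C * vacScale A J)).mono' hfc.aestronglyMeasurable ?_
    have h2 : ∀ᵐ p ∂((volume : Measure ℝ).prod (volume.restrict (uIoc (-π) π))),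
        p.2 ∈ uIoc (-π) π :=
      Measure.quasiMeasurePreserving_snd.ae (ae_restrict_mem measurableSet_uIoc)
    filter_upwards [h2] with p hp
    refine (hbound _ p.2 (by simp) (abs_le_pi_of_mem_uIoc hp)).trans ?_
    have := one_add_norm_rpow_le β p.1
    rw [mul_one]
    gcongr
  -- For each fixed `t` the integral over `s` already vanishes, so exchanging the two integrals
  -- finishes the argument.
  have hswap := integral_integral_swap hint
  have hinner : ∀ s : ℝ, rhoVacIntegrand A β J h s =
      (1 / (2 * π) : ℂ) * ((1 / (2 * π) : ℂ) * ∫ t in uIoc (-π) π, f s t) := by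
    intro s
    unfold rhoVacIntegrand Fvac
    rw [intervalIntegral.integral_const_mul, intervalIntegral.integral_of_le
      (by linarith [Real.pi_pos]), uIoc_of_le (by linarith [Real.pi_pos]), hf]
    simp only
    rw [integral_mul_const]
    ring
  unfold rhoVac
  simp_rw [hinner]
  rw [integral_const_mul, integral_const_mul, hswap,
    setIntegral_congr_fun measurableSet_uIoc (g := fun _ => (0 : ℂ))
      (fun t ht => hzero t (abs_le_pi_of_mem_uIoc ht))]
  simp

end Fixed

/-! ### The contribution of the dual primaries -/

/-- The part of the spin-`J` Laplace transform that is not due to the dual vacuum. -/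
noncomputable def CFTData.laplaceRemainder (S : CFTData) (J : ℤ) (βL : ℂ) : ℂ :=
  Complex.exp (S.A * βL) * S.laplace J βL - Fvac S.A βL J

namespace CFTData.IsModularCFT

variable {S : CFTData}

/-- After S-inversion the vacuum part of the integrand is literally `vacIntegrand`, so the
subtraction is exact. -/
theorem reducedZ_sub_vacIntegrand (hS : S.IsModularCFT) {βL z : ℂ} (J : ℤ) (hz : 0 < z.re)
    (hw : 0 < (βL - z).re) :
    Complex.exp (z * J) * S.reducedZ (βL - z) z - vacIntegrand S.A J βL z =
      Complex.exp (z * J) * (4 * π ^ 2 / (z * (βL - z))) ^ (1 / 2 : ℂ) *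
        Complex.exp (4 * π ^ 2 * S.A / (βL - z) + 4 * π ^ 2 * S.A / z) *
        S.primarySum (4 * π ^ 2 / (βL - z)) (4 * π ^ 2 / z) := by
  rw [hS.reducedZ_inversion hw hz, mul_comm (βL - z) z]
  unfold CFTData.reducedZ vacIntegrand
  have h : (S.A : ℂ) * (4 * π ^ 2 / (βL - z) + 4 * π ^ 2 / z) =
      4 * π ^ 2 * S.A / (βL - z) + 4 * π ^ 2 * S.A / z := by ring
  rw [h]
  ring

theorem continuous_reducedZ_segment (hS : S.IsModularCFT) {α : ℝ} (hα : 0 < α) {βL : ℂ}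
    (hβ : α < βL.re) :
    Continuous fun t : ℝ =>
      S.reducedZ (βL - ((α : ℂ) + (t : ℂ) * Complex.I)) ((α : ℂ) + (t : ℂ) * Complex.I) := by
  have := hS.continuous_primarySum_segment hα hβ
  unfold CFTData.reducedZ
  fun_prop

theorem laplaceRemainder_eq (hS : S.IsModularCFT) {β : ℝ} {J : ℤ} (hJ : SmallAlpha S.A β J)
    {βL : ℂ} (hβL : β ≤ βL.re) :
    2 * π * S.laplaceRemainder J βL =
      ∫ t in (-π)..π, (Complex.exp (((alphaJ S.A J : ℂ) + (t : ℂ) * Complex.I) * J) *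
        S.reducedZ (βL - ((alphaJ S.A J : ℂ) + (t : ℂ) * Complex.I))
          ((alphaJ S.A J : ℂ) + (t : ℂ) * Complex.I) -
        vacIntegrand S.A J βL ((alphaJ S.A J : ℂ) + (t : ℂ) * Complex.I)) := by
  have hα := hJ.alphaJ_pos hS.A_pos
  have hα2 := hJ.2.2
  have hαβ : alphaJ S.A J < βL.re := by linarith
  rw [intervalIntegral.integral_sub, hS.integral_reducedZ_segment hα hαβ hJ.1]
  · unfold CFTData.laplaceRemainder Fvac
    rw [intervalIntegral.integral_const_mul, mul_sub, ← mul_assoc (2 * (π : ℂ)) (1 / (2 * π))]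
    have : (2 * (π : ℂ)) * (1 / (2 * π)) = 1 := by
      have : (π : ℂ) ≠ 0 := by exact_mod_cast Real.pi_ne_zero
      field_simp
    rw [this, one_mul]
  · exact ((continuous_exp_segment _ J).mul
      (hS.continuous_reducedZ_segment hα hαβ)).intervalIntegrable _ _
  · refine (continuous_vacIntegrand S.A J continuous_const (by fun_prop) (fun t => ?_)
      (fun t => ?_)).intervalIntegrable _ _
    · simpa using hα
    · simpa using hαβ

theorem norm_remainder_integrand_le (hS : S.IsModularCFT) {β : ℝ} (hβ : 0 < β) :
    ∃ C K κ : ℝ, 0 < C ∧ 0 < K ∧ 0 < κ ∧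
    ∀ (α s t : ℝ) (J : ℤ), 0 < α → α ≤ 1 → α ≤ β / 2 → |t| ≤ π →
      α * J = 4 * π ^ 2 * S.A / α →
      ‖Complex.exp (((α : ℂ) + (t : ℂ) * Complex.I) * J) *
          S.reducedZ (((β : ℂ) + (s : ℂ) * Complex.I) - ((α : ℂ) + (t : ℂ) * Complex.I))
          ((α : ℂ) + (t : ℂ) * Complex.I) -
        vacIntegrand S.A J ((β : ℂ) + (s : ℂ) * Complex.I)
          ((α : ℂ) + (t : ℂ) * Complex.I)‖ ≤
      C * (α⁻¹ * (α⁻¹ * Real.exp (2 * (4 * π ^ 2 * S.A / α)))) * Real.exp (-κ / α) *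
        Real.exp (K * (1 + s ^ 2)) := by
  obtain ⟨C, K, κ, hC, hK, hκ, hP⟩ := hS.exp_mul_realPrimarySum_le
  have hpi := Real.pi_pos
  have hA := hS.A_pos
  -- `C₁` makes `a₀ = 1/(C₁(1 + s²))` a lower bound for `Re(4π²/(β_L - z))`. The factor `e^{K/a}` of
  -- the primary bound thus becomes `e^{KC₁(1+s²)}`.
  set C₁ : ℝ := 1 + (β ^ 2 + 2 * π ^ 2 + 2) / (2 * π ^ 2 * β) with hC₁
  have hC₁1 : 1 ≤ C₁ := by
    rw [hC₁, le_add_iff_nonneg_right]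
    positivity
  refine ⟨√(4 * π ^ 2 / (β / 2)) * Real.exp (4 * π ^ 2 * S.A / (β / 2)) * C, K * C₁, κ,
    by positivity, by positivity, hκ, fun α s t J hα hα1 hαβ ht hJ => ?_⟩
  set z : ℂ := (α : ℂ) + (t : ℂ) * Complex.I with hz
  set βL : ℂ := (β : ℂ) + (s : ℂ) * Complex.I with hβL
  have hzre : z.re = α := by simp [hz]
  have hzim : z.im = t := by simp [hz]
  have hzα : α ≤ ‖z‖ := by
    rw [← hzre]
    exact Complex.re_le_norm z
  set w : ℂ := βL - z with hw
  have hwre : w.re = β - α := by simp [hw, hβL, hz]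
  have hwim : w.im = s - t := by simp [hw, hβL, hz]
  have hwn : β / 2 ≤ ‖w‖ := by
    refine le_trans ?_ (Complex.re_le_norm w)
    linarith
  have hb : (4 * (π : ℂ) ^ 2 / z).re = 4 * π ^ 2 * α / (α ^ 2 + t ^ 2) := by
    rw [Complex.re_four_pi_sq_div, hzre, Complex.normSq_apply, hzre, hzim]
    ring
  have hb0 : 0 < 4 * π ^ 2 * α / (α ^ 2 + t ^ 2) := by positivity
  set a₀ : ℝ := 1 / (C₁ * (1 + s ^ 2)) with ha₀
  have hden : 1 ≤ C₁ * (1 + s ^ 2) := by nlinarith [sq_nonneg s]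
  have ha₀0 : 0 < a₀ := by positivity
  have ha₀1 : a₀ ≤ 1 := by
    rw [ha₀, div_le_one (by positivity)]
    exact hden
  have ha : a₀ ≤ (4 * (π : ℂ) ^ 2 / w).re := by
    rw [Complex.re_four_pi_sq_div, Complex.normSq_apply, hwre, hwim, ha₀]
    have hpos : 0 < β - α := by linarith
    have h1 : (β - α) * (β - α) + (s - t) * (s - t) ≤
        (β ^ 2 + 2 * π ^ 2 + 2) * (1 + s ^ 2) := by
      have ht2 : t ^ 2 ≤ π ^ 2 := by
        rw [← sq_abs]
        gcongr
      have h2 : (β - α) * (β - α) ≤ β ^ 2 := by nlinarith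
      have h3 : (s - t) * (s - t) ≤ 2 * s ^ 2 + 2 * t ^ 2 := by nlinarith [sq_nonneg (s + t)]
      have h4 : 0 ≤ (β ^ 2 + 2 * π ^ 2) * s ^ 2 := by positivity
      linarith
    have h5 : 2 * π ^ 2 * β * ((β ^ 2 + 2 * π ^ 2 + 2) / (2 * π ^ 2 * β)) =
        β ^ 2 + 2 * π ^ 2 + 2 := by field_simp
    have hn : 0 < (β - α) * (β - α) + (s - t) * (s - t) :=
      add_pos_of_pos_of_nonneg (mul_pos hpos hpos) (mul_self_nonneg _)
    rw [div_le_div_iff₀ (by positivity) hn, one_mul]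
    refine h1.trans ?_
    rw [← h5]
    have h6 : (β ^ 2 + 2 * π ^ 2 + 2) / (2 * π ^ 2 * β) ≤ C₁ := by rw [hC₁]; linarith
    have h7 : 2 * π ^ 2 * β ≤ 4 * π ^ 2 * (β - α) := by
      have : 0 < π ^ 2 := by positivity
      nlinarith
    calc _ ≤ 4 * π ^ 2 * (β - α) * C₁ * (1 + s ^ 2) := by gcongr
      _ = _ := by ring
  rw [hS.reducedZ_sub_vacIntegrand J (by rw [hzre]; exact hα) (by rw [hwre]; linarith)]
  have f1 : ‖Complex.exp (z * J)‖ = Real.exp (4 * π ^ 2 * S.A / α) := by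
    rw [Complex.norm_exp, ← hJ]
    congr 1
    simp [hzre]
  have f2 : ‖(4 * (π : ℂ) ^ 2 / (z * w)) ^ (1 / 2 : ℂ)‖ ≤ √(4 * π ^ 2 / (β / 2)) * α⁻¹ := by
    rw [Complex.norm_four_pi_sq_div_cpow, norm_mul]
    have e1 : √(α⁻¹) ≤ α⁻¹ := Real.sqrt_le_self_of_one_le ((one_le_inv₀ hα).2 hα1)
    have e2 : √(4 * π ^ 2 / (‖z‖ * ‖w‖)) ≤ √(4 * π ^ 2 / (β / 2) * α⁻¹) := by
      apply Real.sqrt_le_sqrt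
      rw [← div_eq_mul_inv, div_div, mul_comm (β / 2)]
      gcongr
    rw [Real.sqrt_mul (by positivity)] at e2
    refine e2.trans ?_
    gcongr
  have f3 : ‖Complex.exp (4 * π ^ 2 * S.A / w + 4 * π ^ 2 * S.A / z)‖ ≤
      Real.exp (4 * π ^ 2 * S.A / (β / 2)) *
        Real.exp (S.A * (4 * π ^ 2 * α / (α ^ 2 + t ^ 2))) := by
    rw [Complex.norm_exp, ← Real.exp_add, Complex.add_re]
    have h1 := Complex.re_le_of_div_of_pos_le (r := 4 * π ^ 2 * S.A) (by positivity)
      (half_pos hβ) hwn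
    push_cast at h1
    have h2 : (4 * (π : ℂ) ^ 2 * S.A / z).re = S.A * (4 * π ^ 2 * α / (α ^ 2 + t ^ 2)) := by
      rw [← hb, ← Complex.re_ofReal_mul]
      congr 1
      ring
    rw [h2]
    gcongr
  have f4 : ‖S.primarySum (4 * π ^ 2 / w) (4 * π ^ 2 / z)‖ ≤
      S.realPrimarySum a₀ (4 * π ^ 2 * α / (α ^ 2 + t ^ 2)) := by
    refine norm_primarySum_le.trans ?_
    rw [hb]
    exact hS.realPrimarySum_anti ha₀0 ha hb0 le_rfl
  have f5 := hP α t a₀ hα hα1 ht ha₀0 ha₀1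
  have f6 : K / a₀ = K * C₁ * (1 + s ^ 2) := by
    rw [ha₀]
    field_simp
  rw [f6] at f5
  rw [norm_mul, norm_mul, norm_mul, f1]
  calc _ ≤ Real.exp (4 * π ^ 2 * S.A / α) * (√(4 * π ^ 2 / (β / 2)) * α⁻¹) *
        (Real.exp (4 * π ^ 2 * S.A / (β / 2)) *
          Real.exp (S.A * (4 * π ^ 2 * α / (α ^ 2 + t ^ 2)))) *
        S.realPrimarySum a₀ (4 * π ^ 2 * α / (α ^ 2 + t ^ 2)) := by gcongr
    _ = Real.exp (4 * π ^ 2 * S.A / α) * (√(4 * π ^ 2 / (β / 2)) * α⁻¹) *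
        Real.exp (4 * π ^ 2 * S.A / (β / 2)) *
        (Real.exp (S.A * (4 * π ^ 2 * α / (α ^ 2 + t ^ 2))) *
        S.realPrimarySum a₀ (4 * π ^ 2 * α / (α ^ 2 + t ^ 2))) := by ring
    _ ≤ Real.exp (4 * π ^ 2 * S.A / α) * (√(4 * π ^ 2 / (β / 2)) * α⁻¹) *
        Real.exp (4 * π ^ 2 * S.A / (β / 2)) *
        (C * Real.exp (K * C₁ * (1 + s ^ 2)) * α⁻¹ *
          Real.exp (4 * π ^ 2 * S.A / α - κ / α)) := by gcongr
    _ = _ := by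
      rw [two_mul (4 * π ^ 2 * S.A / α), Real.exp_add, sub_eq_add_neg, Real.exp_add, neg_div]
      ring

theorem norm_laplaceRemainder_le (hS : S.IsModularCFT) {β : ℝ} (hβ : 0 < β) :
    ∃ C K κ : ℝ, 0 < C ∧ 0 < K ∧ 0 < κ ∧ ∀ (J : ℤ) (s : ℝ), SmallAlpha S.A β J →
      ‖S.laplaceRemainder J ((β : ℂ) + (s : ℂ) * Complex.I)‖ ≤
      C * ((alphaJ S.A J)⁻¹ * vacScale S.A J) * Real.exp (-κ / alphaJ S.A J) *
        Real.exp (K * (1 + s ^ 2)) := by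
  obtain ⟨C, K, κ, hC, hK, hκ, h⟩ := hS.norm_remainder_integrand_le hβ
  have hpi := Real.pi_pos
  refine ⟨C, K, κ, hC, hK, hκ, fun J s hJ => ?_⟩
  have h1 := hS.laplaceRemainder_eq hJ (βL := (β : ℂ) + (s : ℂ) * Complex.I) (by simp)
  have h2 := congrArg norm h1
  rw [norm_mul, norm_mul, Complex.norm_real, Real.norm_of_nonneg hpi.le] at h2
  have h3 := intervalIntegral.norm_integral_le_of_norm_le_const (a := -π) (b := π)
    (fun t ht => h (alphaJ S.A J) s t J (hJ.alphaJ_pos hS.A_pos) hJ.2.1 hJ.2.2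
      (abs_le_pi_of_mem_uIoc ht) (hJ.alphaJ_mul hS.A_pos))
  have h4 : |π - -π| = 2 * π := by rw [sub_neg_eq_add, ← two_mul, abs_of_pos (by positivity)]
  have h5 : ‖(2 : ℂ)‖ = 2 := by norm_num
  rw [← h2, h4, h5, mul_comm (2 * π)] at h3
  refine (le_of_mul_le_mul_right h3 (by positivity)).trans_eq ?_
  rw [hJ.four_pi_sq_div hS.A_pos, vacScale]
  ring_nf

/-- Positivity reduces the Laplace transform to `s = 0`, where it is remainder plus vacuum and both
are under control. This replaces the growth in `s` of the previous bound, which is useless for large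
`s`. -/
theorem norm_laplaceRemainder_le_const (hS : S.IsModularCFT) {β : ℝ} (hβ : 0 < β) :
    ∃ C : ℝ, 0 < C ∧ ∀ (J : ℤ) (s : ℝ), SmallAlpha S.A β J →
      ‖S.laplaceRemainder J ((β : ℂ) + (s : ℂ) * Complex.I)‖ ≤
      C * ((alphaJ S.A J)⁻¹ * vacScale S.A J) := by
  obtain ⟨C₁, K, κ, hC₁, hK, hκ, h₁⟩ := hS.norm_laplaceRemainder_le hβ
  obtain ⟨C₂, hC₂, h₂⟩ := norm_Fvac_le hS.A_pos hβ
  refine ⟨C₂ + (C₁ * Real.exp K + C₂), by positivity, fun J s hJ => ?_⟩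
  have hα := hJ.alphaJ_pos hS.A_pos
  have hα1 : 1 ≤ (alphaJ S.A J)⁻¹ := (one_le_inv₀ hα).2 hJ.2.1
  have hv := hJ.vacScale_pos hS.A_pos
  have hF : ∀ s : ℝ, ‖Fvac S.A ((β : ℂ) + (s : ℂ) * Complex.I) J‖ ≤
      C₂ * ((alphaJ S.A J)⁻¹ * vacScale S.A J) := by
    intro s
    refine (h₂ J _ hJ (by simp)).trans ?_
    have e1 : (1 + ‖(β : ℂ) + (s : ℂ) * Complex.I‖) ^ (-(3 / 2) : ℝ) ≤ 1 :=
      Real.rpow_le_one_of_one_le_of_nonpos (le_add_of_nonneg_right (norm_nonneg _))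
        (by norm_num)
    calc _ ≤ C₂ * vacScale S.A J * 1 := by gcongr
      _ ≤ C₂ * vacScale S.A J * (alphaJ S.A J)⁻¹ := by gcongr
      _ = _ := by ring
  have hR : ‖S.laplaceRemainder J (β : ℂ)‖ ≤
      C₁ * Real.exp K * ((alphaJ S.A J)⁻¹ * vacScale S.A J) := by
    have e1 := h₁ J 0 hJ
    have e2 : Real.exp (-κ / alphaJ S.A J) ≤ 1 := by
      rw [Real.exp_le_one_iff, neg_div, neg_nonpos]
      positivity
    simp only [Complex.ofReal_zero, zero_mul, add_zero, ne_eq, OfNat.ofNat_ne_zero,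
      not_false_eq_true, zero_pow, mul_one] at e1
    calc _ ≤ C₁ * ((alphaJ S.A J)⁻¹ * vacScale S.A J) * 1 * Real.exp K := by
          refine e1.trans ?_
          gcongr
      _ = _ := by ring
  have hL : ‖Complex.exp (S.A * ((β : ℂ) + (s : ℂ) * Complex.I)) *
      S.laplace J ((β : ℂ) + (s : ℂ) * Complex.I)‖ ≤
      (C₁ * Real.exp K + C₂) * ((alphaJ S.A J)⁻¹ * vacScale S.A J) := by
    have e1 := norm_laplace_le (S := S) J ((β : ℂ) + (s : ℂ) * Complex.I)
    have e2 : ((β : ℂ) + (s : ℂ) * Complex.I).re = β := by simp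
    rw [e2] at e1
    have e3 : ‖Complex.exp (S.A * ((β : ℂ) + (s : ℂ) * Complex.I))‖ =
        ‖Complex.exp (S.A * (β : ℂ))‖ := by
      rw [Complex.norm_exp, Complex.norm_exp]
      simp
    rw [norm_mul, e3]
    have e4 : Complex.exp (S.A * (β : ℂ)) * S.laplace J β =
        S.laplaceRemainder J (β : ℂ) + Fvac S.A (β : ℂ) J := by
      unfold CFTData.laplaceRemainder
      ring
    have e5 := hF 0
    simp only [Complex.ofReal_zero, zero_mul, add_zero] at e5
    calc _ ≤ ‖Complex.exp (S.A * (β : ℂ))‖ * ‖S.laplace J (β : ℂ)‖ := by gcongr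
      _ = ‖S.laplaceRemainder J (β : ℂ) + Fvac S.A (β : ℂ) J‖ := by rw [← norm_mul, e4]
      _ ≤ _ := (norm_add_le _ _).trans ((add_le_add hR e5).trans_eq (by ring))
  unfold CFTData.laplaceRemainder
  refine (norm_sub_le _ _).trans ((add_le_add hL (hF s)).trans_eq (by ring))

theorem continuous_laplace (hS : S.IsModularCFT) (J : ℤ) {β : ℝ} (hβ : 0 < β) :
    Continuous fun s : ℝ => S.laplace J ((β : ℂ) + (s : ℂ) * Complex.I) := by
  refine continuous_of_dominated (bound := fun h : ℝ => Real.exp (-h * β))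
    (fun s => by fun_prop) (fun s => Eventually.of_forall fun h => ?_)
    (hS.integrable_twist J hβ) (Eventually.of_forall fun h => by fun_prop)
  rw [norm_exp_twist]
  simp

end CFTData.IsModularCFT

/-! ### Fourier inversion for test functions -/

/-- The Laplace-Fourier transform of a test function along `Re = β`. -/
noncomputable def testTransform (A β : ℝ) (g : ℝ → ℂ) (s : ℝ) : ℂ :=
  (1 / (2 * π) : ℂ) * ∫ h : ℝ, g h *
    Complex.exp (((β : ℂ) + (s : ℂ) * Complex.I) * ((h : ℂ) - A))

section

open scoped FourierTransform

variable {A β : ℝ} {g : ℝ → ℂ}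

theorem norm_exp_shift (A β s h : ℝ) :
    ‖Complex.exp (((β : ℂ) + (s : ℂ) * Complex.I) * ((h : ℂ) - A))‖ =
      Real.exp (β * (h - A)) := by
  rw [← Complex.ofReal_sub, norm_exp_line]

theorem integrable_mul_exp (hg : Continuous g) (hc : HasCompactSupport g) (A β : ℝ) :
    Integrable fun h : ℝ => ‖g h‖ * Real.exp (β * (h - A)) := by
  refine Continuous.integrable_of_hasCompactSupport (by fun_prop) ?_
  exact hc.norm.mul_right

theorem continuous_testTransform (hg : Continuous g) (hc : HasCompactSupport g) :
    Continuous (testTransform A β g) := by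
  unfold testTransform
  refine continuous_const.mul ?_
  refine continuous_of_dominated (bound := fun h : ℝ => ‖g h‖ * Real.exp (β * (h - A)))
    (fun s => by fun_prop) (fun s => Eventually.of_forall fun h => ?_)
    (integrable_mul_exp hg hc A β) (Eventually.of_forall fun h => by fun_prop)
  rw [norm_mul, norm_exp_shift]

theorem testTransform_inversion (hg : Continuous g) (hc : HasCompactSupport g)
    (hi : Integrable (testTransform A β g)) (h : ℝ) :
    g h = ∫ s : ℝ, testTransform A β g s *
      Complex.exp (-(((β : ℂ) + (s : ℂ) * Complex.I) * ((h : ℂ) - A))) := by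
  have hpi : (π : ℂ) ≠ 0 := by exact_mod_cast Real.pi_ne_zero
  -- Weighting by `e^{β(x-A)}` reduces the Laplace inversion on `Re = β` to the ordinary one, with
  -- frequency `s = -2πw`.
  set f : ℝ → ℂ := fun x => g x * Complex.exp ((β : ℂ) * ((x : ℂ) - A)) with hf
  have hfc : Continuous f := by fun_prop
  have hfi : Integrable f := hfc.integrable_of_hasCompactSupport hc.mul_right
  have hF : ∀ w : ℝ, 𝓕 f w = 2 * π * Complex.exp (-(2 * π * w * A) * Complex.I) *
      testTransform A β g (-(2 * π) * w) := by
    intro w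
    rw [Real.fourier_real_eq_integral_exp_smul]
    unfold testTransform
    rw [show (2 * π * Complex.exp (-(2 * π * w * A) * Complex.I) : ℂ) * (1 / (2 * π) *
      ∫ h : ℝ, g h * Complex.exp (((β : ℂ) + ((-(2 * π) * w : ℝ) : ℂ) * Complex.I) *
        ((h : ℂ) - A))) = Complex.exp (-(2 * π * w * A) * Complex.I) *
      ∫ h : ℝ, g h * Complex.exp (((β : ℂ) + ((-(2 * π) * w : ℝ) : ℂ) * Complex.I) *
        ((h : ℂ) - A)) by field_simp, ← integral_const_mul]
    congr 1
    ext x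
    have he : Complex.exp (((-2 * π * x * w : ℝ) : ℂ) * Complex.I) *
        Complex.exp ((β : ℂ) * ((x : ℂ) - A)) =
        Complex.exp (-(2 * π * w * A) * Complex.I) *
        Complex.exp (((β : ℂ) + ((-(2 * π) * w : ℝ) : ℂ) * Complex.I) * ((x : ℂ) - A)) := by
      rw [← Complex.exp_add, ← Complex.exp_add]
      congr 1
      push_cast
      ring
    rw [hf, smul_eq_mul]
    linear_combination g x * he
  have hFi : Integrable (𝓕 f) := by
    rw [funext hF]
    refine (((hi.comp_mul_left' (R := -(2 * π)) (by
      simp))).bdd_mul (c := 2 * π) (by fun_prop)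
      (Eventually.of_forall fun w => ?_))
    rw [norm_mul, Complex.norm_exp]
    simp [abs_of_pos Real.pi_pos]
  have hinv := congrFun (hfc.fourierInv_fourier_eq hfi hFi) h
  rw [Real.fourierInv_eq'] at hinv
  have h1 : ∀ w : ℝ, Complex.exp (((2 * π * inner ℝ w h : ℝ) : ℂ) * Complex.I) • 𝓕 f w =
      2 * π * (testTransform A β g (-(2 * π) * w) *
        Complex.exp (-((((-(2 * π) * w : ℝ) : ℂ) * Complex.I) * ((h : ℂ) - A)))) := by
    intro w
    rw [hF, smul_eq_mul]
    have : Complex.exp (((2 * π * inner ℝ w h : ℝ) : ℂ) * Complex.I) *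
        Complex.exp (-(2 * π * w * A) * Complex.I) =
        Complex.exp (-((((-(2 * π) * w : ℝ) : ℂ) * Complex.I) * ((h : ℂ) - A))) := by
      rw [← Complex.exp_add]
      congr 1
      simp only [RCLike.inner_apply, conj_trivial]
      push_cast
      ring
    rw [← this]
    ring
  simp_rw [h1] at hinv
  rw [integral_const_mul, Measure.integral_comp_mul_left (fun s : ℝ => testTransform A β g s *
        Complex.exp (-(((s : ℂ) * Complex.I) * ((h : ℂ) - A)))) (-(2 * π))] at hinv
  have h2 : |(-(2 * π))⁻¹| = (2 * π)⁻¹ := by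
    rw [inv_neg, abs_neg, abs_of_pos (by have := Real.pi_pos; positivity)]
  rw [h2, Complex.real_smul, ← mul_assoc, show (2 * (π : ℂ)) * (((2 * π)⁻¹ : ℝ) : ℂ) = 1 by
    push_cast; field_simp, one_mul, hf] at hinv
  beta_reduce at hinv
  have h3 : g h = Complex.exp (-((β : ℂ) * ((h : ℂ) - A))) *
      (g h * Complex.exp ((β : ℂ) * ((h : ℂ) - A))) := by
    rw [mul_left_comm, ← Complex.exp_add]
    simp
  rw [h3, ← hinv, ← integral_const_mul]
  congr 1
  ext s
  rw [mul_left_comm, ← Complex.exp_add]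
  congr 2
  ring

theorem SmallAlpha.integral_mul_rhoVac {J : ℤ} (hJ : SmallAlpha A β J) (hA : 0 < A)
    (hβ : 0 < β) (hg : Continuous g) (hc : HasCompactSupport g) :
    ∫ h : ℝ, g h * rhoVac A β J h = (1 / 2 : ℂ) * ∫ s : ℝ, testTransform A β g s *
      Fvac A ((β : ℂ) + (s : ℂ) * Complex.I) J := by
  have hFc := hJ.continuous_Fvac hA
  have hFi := hJ.integrable_Fvac hA hβ
  have hint : Integrable (Function.uncurry fun h s : ℝ => g h * rhoVacIntegrand A β J h s)
      ((volume : Measure ℝ).prod volume) := by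
    have h1 := (integrable_mul_exp hg hc A β).mul_prod
      (hFi.const_mul (1 / (2 * π) : ℂ)).norm
    refine h1.mono' ?_ (Eventually.of_forall fun p => ?_)
    · refine Continuous.aestronglyMeasurable ?_
      unfold Function.uncurry rhoVacIntegrand
      have : Continuous fun p : ℝ × ℝ => Fvac A ((β : ℂ) + (p.2 : ℂ) * Complex.I) J :=
        hFc.comp continuous_snd
      fun_prop
    · unfold Function.uncurry rhoVacIntegrand
      rw [norm_mul, norm_mul, norm_exp_shift]
      exact le_of_eq (by ring)
  have h2 : ∀ h : ℝ, g h * rhoVac A β J h =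
      (1 / 2 : ℂ) * ∫ s : ℝ, g h * rhoVacIntegrand A β J h s := by
    intro h
    unfold rhoVac
    rw [integral_const_mul]
    ring
  simp_rw [h2]
  rw [integral_const_mul, integral_integral_swap hint]
  congr 2
  ext s
  unfold testTransform rhoVacIntegrand
  rw [mul_assoc, mul_comm (∫ h : ℝ, g h *
    Complex.exp (((β : ℂ) + (s : ℂ) * Complex.I) * ((h : ℂ) - A))), ← mul_assoc,
    ← integral_const_mul]
  congr 1
  ext h
  ring

/-- Expand `g` by its inversion formula and apply Fubini. The kernel has modulus `e^{-β(h-A)}`,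
integrable for the twist measure even where `g` vanishes. -/
theorem CFTData.IsModularCFT.integral_twistMeasure {S : CFTData} (hS : S.IsModularCFT) (J : ℤ)
    (hβ : 0 < β) (hg : Continuous g) (hc : HasCompactSupport g)
    (hi : Integrable (testTransform S.A β g)) :
    ∫ h, g h ∂S.twistMeasure J = ∫ s : ℝ, testTransform S.A β g s *
      (Complex.exp (S.A * ((β : ℂ) + (s : ℂ) * Complex.I)) *
        S.laplace J ((β : ℂ) + (s : ℂ) * Complex.I)) := by
  have := hS.isFiniteMeasureOnCompacts_twist J
  have hΦ := continuous_testTransform (A := S.A) (β := β) hg hc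
  have hint : Integrable (Function.uncurry fun h s : ℝ => testTransform S.A β g s *
      Complex.exp (-(((β : ℂ) + (s : ℂ) * Complex.I) * ((h : ℂ) - S.A))))
      ((S.twistMeasure J).prod volume) := by
    have h1 := ((hS.integrable_twist J hβ).const_mul (Real.exp (β * S.A))).mul_prod hi.norm
    refine h1.mono' ?_ (Eventually.of_forall fun p => ?_)
    · refine Continuous.aestronglyMeasurable ?_
      unfold Function.uncurry
      have : Continuous fun p : ℝ × ℝ => testTransform S.A β g p.2 := hΦ.comp continuous_snd
      fun_prop
    · unfold Function.uncurry
      rw [norm_mul, Complex.exp_neg, norm_inv, norm_exp_shift, ← Real.exp_neg, ← Real.exp_add]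
      refine le_of_eq ?_
      rw [mul_comm]
      congr 2
      ring
  rw [integral_congr_ae (Eventually.of_forall fun h => testTransform_inversion hg hc hi h),
    integral_integral_swap hint]
  congr 1
  ext s
  rw [integral_const_mul]
  congr 1
  unfold CFTData.laplace
  rw [← integral_const_mul]
  congr 1
  ext h
  rw [← Complex.exp_add]
  congr 1
  ring

end

/-! ### Decay of the transform of a rescaled test function -/

section TestFunction

variable {φ : ℝ → ℂ}

theorem integral_mul_exp_eq_iteratedDeriv {c : ℂ} (hc : c ≠ 0) (N : ℕ) :
    ∀ {φ : ℝ → ℂ}, ContDiff ℝ ∞ φ → HasCompactSupport φ →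
    ∫ x : ℝ, φ x * Complex.exp (c * x) =
      (-c⁻¹) ^ N * ∫ x : ℝ, iteratedDeriv N φ x * Complex.exp (c * x) := by
  induction N with
  | zero => intro φ _ _; simp
  | succ N ih =>
    intro φ hφ hs
    have hd := (contDiff_infty_iff_deriv.1 hφ)
    have hexp : ∀ x : ℝ, HasDerivAt (fun x : ℝ => c⁻¹ * Complex.exp (c * x))
        (Complex.exp (c * x)) x := by
      intro x
      have h1 : HasDerivAt (fun x : ℝ => c * (x : ℂ)) c x := by
        simpa using (Complex.ofRealCLM.hasDerivAt (x := x)).const_mul c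
      exact ((h1.cexp).const_mul c⁻¹).congr_deriv (by field_simp)
    have hcont : Continuous fun x : ℝ => Complex.exp (c * x) := by fun_prop
    have hφc := hφ.continuous
    have hdc := hd.2.continuous
    have hparts := integral_mul_deriv_eq_deriv_mul_of_integrable (u := φ) (u' := deriv φ)
      (v := fun x : ℝ => c⁻¹ * Complex.exp (c * x)) (v' := fun x : ℝ => Complex.exp (c * x))
      (fun x _ => (hd.1 x).hasDerivAt) (fun x _ => hexp x)
      ((hφc.mul hcont).integrable_of_hasCompactSupport hs.mul_right)
      ((hdc.mul (continuous_const.mul hcont)).integrable_of_hasCompactSupport hs.deriv.mul_right)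
      ((hφc.mul (continuous_const.mul hcont)).integrable_of_hasCompactSupport hs.mul_right)
    have h3 : ∀ x : ℝ, deriv φ x * (c⁻¹ * Complex.exp (c * x)) =
        c⁻¹ * (deriv φ x * Complex.exp (c * x)) := fun x => by ring
    simp_rw [h3] at hparts
    rw [hparts, integral_const_mul, ih hd.2 hs.deriv, iteratedDeriv_succ', pow_succ]
    ring

theorem continuous_rescale (hφ : Continuous φ) (hstar lam : ℝ) :
    Continuous (rescale φ hstar lam) := by
  unfold rescale
  fun_prop

theorem hasCompactSupport_rescale (hs : HasCompactSupport φ) (hstar : ℝ) {lam : ℝ}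
    (hlam : 0 < lam) : HasCompactSupport (rescale φ hstar lam) := by
  have h := hs.comp_homeomorph
    ((Homeomorph.addRight (-hstar)).trans (Homeomorph.mulRight₀ lam⁻¹ (inv_pos.2 hlam).ne'))
  have e : (φ ∘ ((Homeomorph.addRight (-hstar)).trans
      (Homeomorph.mulRight₀ lam⁻¹ (inv_pos.2 hlam).ne'))) =
      fun h => φ ((h - hstar) / lam) := by
    ext h
    simp [sub_eq_add_neg, div_eq_mul_inv]
  rw [e] at h
  exact h.mul_left

theorem integral_rescale_mul_exp {lam : ℝ} (hlam : 0 < lam) (hstar A : ℝ) (c : ℂ) :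
    ∫ h : ℝ, rescale φ hstar lam h * Complex.exp (c * ((h : ℂ) - A)) =
      Complex.exp (c * ((hstar : ℂ) - A)) * ∫ x : ℝ, φ x * Complex.exp (c * lam * x) := by
  have hl : (lam : ℂ) ≠ 0 := by exact_mod_cast hlam.ne'
  rw [← integral_add_right_eq_self _ hstar]
  set F : ℝ → ℂ := fun x => (lam : ℂ)⁻¹ * (Complex.exp (c * ((hstar : ℂ) - A)) *
    (φ x * Complex.exp (c * lam * x))) with hF
  have h1 : ∀ h : ℝ, rescale φ hstar lam (h + hstar) *
      Complex.exp (c * (((h + hstar : ℝ) : ℂ) - A)) = F (h / lam) := by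
    intro h
    rw [hF]
    unfold rescale
    have e : Complex.exp (c * (((h + hstar : ℝ) : ℂ) - A)) =
        Complex.exp (c * ((hstar : ℂ) - A)) * Complex.exp (c * lam * ((h / lam : ℝ) : ℂ)) := by
      rw [← Complex.exp_add]
      congr 1
      push_cast
      field_simp
      ring
    rw [e, add_sub_cancel_right]
    ring
  simp_rw [h1]
  rw [Measure.integral_comp_div F lam, hF, integral_const_mul, integral_const_mul, abs_of_pos hlam,
    Complex.real_smul, ← mul_assoc, mul_inv_cancel₀ hl, one_mul]

/-- Integrate by parts `N` times; each step gains `(λ|β + is|)^{-1}`. The bounds `λ ≤ Λ` and `h⋆ ≤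
b` keep the real exponentials, hence the constant, uniform. -/
theorem norm_testTransform_rescale_le (hφ : ContDiff ℝ ∞ φ) (hs : HasCompactSupport φ)
    (A : ℝ) {β : ℝ} (hβ : 0 < β) (Λ b : ℝ) (N : ℕ) : ∃ C : ℝ, 0 ≤ C ∧
    ∀ lam hstar s : ℝ, 0 < lam → lam ≤ Λ → hstar ≤ b →
      ‖testTransform A β (rescale φ hstar lam) s‖ ≤
        C * ((lam * ‖(β : ℂ) + (s : ℂ) * Complex.I‖) ^ N)⁻¹ := by
  have hpi := Real.pi_gt_three
  have hsmooth : ContDiff ℝ ∞ (iteratedDeriv N φ) := by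
    rw [iteratedDeriv_eq_iterate]
    exact hφ.iterate_deriv N
  have hsupp : HasCompactSupport (iteratedDeriv N φ) := by
    clear hsmooth
    induction N with
    | zero => simpa using hs
    | succ N ih =>
      rw [iteratedDeriv_succ]
      exact ih.deriv
  have hcont := hsmooth.continuous
  set I : ℝ := ∫ x : ℝ, ‖iteratedDeriv N φ x‖ * Real.exp (β * Λ * |x|) with hI
  have hI0 : 0 ≤ I := integral_nonneg fun x => by positivity
  have hint : Integrable fun x : ℝ => ‖iteratedDeriv N φ x‖ * Real.exp (β * Λ * |x|) :=
    Continuous.integrable_of_hasCompactSupport (by fun_prop) hsupp.norm.mul_right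
  refine ⟨Real.exp (β * (b - A)) * I, by positivity, fun lam hstar s hlam hΛ hb => ?_⟩
  set c : ℂ := (β : ℂ) + (s : ℂ) * Complex.I with hc
  have hcre : c.re = β := by simp [hc]
  have hc0 : c ≠ 0 := Complex.ne_zero_of_re_pos (by rwa [hcre])
  have hl : (lam : ℂ) ≠ 0 := by exact_mod_cast hlam.ne'
  unfold testTransform
  rw [integral_rescale_mul_exp hlam, integral_mul_exp_eq_iteratedDeriv (mul_ne_zero hc0 hl) N hφ hs,
    norm_mul, norm_mul, norm_exp_shift, norm_mul, norm_pow, norm_neg, norm_inv, norm_mul,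
    Complex.norm_real, Real.norm_of_nonneg hlam.le, mul_comm ‖c‖, inv_pow]
  have h1 : ‖(1 / (2 * π) : ℂ)‖ ≤ 1 := by
    rw [norm_div, norm_mul, Complex.norm_real, Real.norm_of_nonneg (by linarith)]
    norm_num
    have : π⁻¹ ≤ 1 := inv_le_one_of_one_le₀ (by linarith)
    linarith
  have h2 : ‖∫ x : ℝ, iteratedDeriv N φ x * Complex.exp (c * lam * x)‖ ≤ I := by
    refine norm_integral_le_of_norm_le hint (Eventually.of_forall fun x => ?_)
    rw [norm_mul, Complex.norm_exp, mul_assoc, ← Complex.ofReal_mul, Complex.re_mul_ofReal, hcre]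
    have : β * (lam * x) ≤ β * Λ * |x| := by
      rw [mul_assoc]
      have h3 : lam * x ≤ Λ * |x| := by
        calc lam * x ≤ lam * |x| := by gcongr; exact le_abs_self x
          _ ≤ _ := by gcongr
      gcongr
    gcongr
  calc _ ≤ 1 * (Real.exp (β * (b - A)) * (((lam * ‖c‖) ^ N)⁻¹ * I)) := by gcongr
    _ = _ := by ring

end TestFunction

/-! ### The smeared difference of densities -/

theorem sq_norm_line (β s : ℝ) : ‖(β : ℂ) + (s : ℂ) * Complex.I‖ ^ 2 = β ^ 2 + s ^ 2 := by
  rw [Complex.sq_norm, Complex.normSq_apply]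
  simp
  ring

theorem integrable_inv_sq_norm_line {β : ℝ} (hβ : 0 < β) :
    Integrable fun s : ℝ => (‖(β : ℂ) + (s : ℂ) * Complex.I‖ ^ 2)⁻¹ := by
  refine (integrable_inv_one_add_sq.const_mul ((1 + β ^ 2) / β ^ 2)).mono' ?_
    (Eventually.of_forall fun s => ?_)
  · refine Continuous.aestronglyMeasurable (Continuous.inv₀ (by fun_prop) fun s => ?_)
    rw [sq_norm_line]
    positivity
  · rw [sq_norm_line, Real.norm_of_nonneg (by positivity), ← div_eq_mul_inv, div_div,
      inv_eq_one_div, div_le_div_iff₀ (by positivity) (by positivity)]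
    nlinarith [sq_nonneg (s * β), sq_nonneg s, sq_nonneg β, sq_nonneg (β ^ 2)]

theorem integrable_testTransform_rescale {φ : ℝ → ℂ} (hφ : ContDiff ℝ ∞ φ)
    (hs : HasCompactSupport φ) (A : ℝ) {β : ℝ} (hβ : 0 < β) {lam : ℝ} (hlam : 0 < lam)
    (hstar : ℝ) : Integrable (testTransform A β (rescale φ hstar lam)) := by
  obtain ⟨C, hC, h⟩ := norm_testTransform_rescale_le hφ hs A hβ lam hstar 2
  refine ((integrable_inv_sq_norm_line hβ).const_mul (C * (lam ^ 2)⁻¹)).mono'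
    (continuous_testTransform (continuous_rescale hφ.continuous _ _)
      (hasCompactSupport_rescale hs hstar hlam)).aestronglyMeasurable
    (Eventually.of_forall fun s => ?_)
  refine (h lam hstar s hlam le_rfl le_rfl).trans_eq ?_
  rw [mul_pow, mul_inv, mul_assoc]

namespace CFTData.IsModularCFT

variable {S : CFTData}

theorem setIntegral_rhoH (hS : S.IsModularCFT) (J : ℤ) (g : ℝ → ℂ) :
    ∫ h in Ioi S.Tgap, g h ∂(S.rhoH J) = (1 / 2 : ℂ) * ∫ h, g h ∂S.twistMeasure J := by
  have h1 : S.rhoH J = (2⁻¹ : NNReal) • S.twistMeasure J := rfl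
  have h2 : (S.twistMeasure J).restrict (Ioi S.Tgap) = S.twistMeasure J :=
    Measure.restrict_eq_self_of_ae_mem (hS.ae_twistMeasure J)
  rw [h1, Measure.restrict_smul, h2, integral_smul_nnreal_measure, NNReal.smul_def,
    Complex.real_smul]
  simp

theorem setIntegral_mul_rhoVac (hS : S.IsModularCFT) {β : ℝ} (hβ : 0 < β) {J : ℤ}
    (hJ : SmallAlpha S.A β J) (g : ℝ → ℂ) :
    ∫ h in Ioi S.Tgap, g h * rhoVac S.A β J h = ∫ h, g h * rhoVac S.A β J h := by
  refine setIntegral_eq_integral_of_forall_compl_eq_zero fun h hh => ?_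
  rw [hJ.rhoVac_eq_zero hS.A_pos hβ ((not_lt.1 hh).trans hS.Tgap_le_A), mul_zero]

/-- A Parseval identity for both densities on the same line `Re = β`. The two uniform bounds on
`Fvac` and the remainder justify combining the integrals. -/
theorem difference_eq (hS : S.IsModularCFT) {β : ℝ} (hβ : 0 < β) {J : ℤ}
    (hJ : SmallAlpha S.A β J) {g : ℝ → ℂ} (hg : Continuous g) (hc : HasCompactSupport g)
    (hi : Integrable (testTransform S.A β g)) :
    (∫ h in Ioi S.Tgap, g h ∂(S.rhoH J)) - ∫ h in Ioi S.Tgap, g h * rhoVac S.A β J h =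
      (1 / 2 : ℂ) * ∫ s : ℝ, testTransform S.A β g s *
        S.laplaceRemainder J ((β : ℂ) + (s : ℂ) * Complex.I) := by
  have hA := hS.A_pos
  have hΦ := continuous_testTransform (A := S.A) (β := β) hg hc
  obtain ⟨C₁, hC₁, h₁⟩ := norm_Fvac_le hA hβ
  obtain ⟨C₂, hC₂, h₂⟩ := hS.norm_laplaceRemainder_le_const hβ
  have hv := hJ.vacScale_pos hA
  have hFc := hJ.continuous_Fvac hA
  have hLc := hS.continuous_laplace J hβ
  have hRc : Continuous fun s : ℝ =>
      S.laplaceRemainder J ((β : ℂ) + (s : ℂ) * Complex.I) := by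
    unfold CFTData.laplaceRemainder
    fun_prop
  have hF : Integrable fun s : ℝ => testTransform S.A β g s *
      Fvac S.A ((β : ℂ) + (s : ℂ) * Complex.I) J := by
    refine hi.mul_bdd (c := C₁ * vacScale S.A J) hFc.aestronglyMeasurable
      (Eventually.of_forall fun s => ?_)
    refine (h₁ J _ hJ (by simp)).trans (mul_le_of_le_one_right (by positivity) ?_)
    exact Real.rpow_le_one_of_one_le_of_nonpos (le_add_of_nonneg_right (norm_nonneg _))
      (by norm_num)
  have hR : Integrable fun s : ℝ => testTransform S.A β g s *
      S.laplaceRemainder J ((β : ℂ) + (s : ℂ) * Complex.I) :=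
    hi.mul_bdd hRc.aestronglyMeasurable (Eventually.of_forall fun s => h₂ J s hJ)
  rw [hS.setIntegral_rhoH, hS.setIntegral_mul_rhoVac hβ hJ, hJ.integral_mul_rhoVac hA hβ hg hc,
    hS.integral_twistMeasure J hβ hg hc hi, ← mul_sub]
  congr 1
  rw [sub_eq_iff_eq_add, ← integral_add hR hF]
  congr 1
  ext s
  unfold CFTData.laplaceRemainder
  ring

/-- The cut `T` is left free: `|s| ≤ T` uses the exponentially small bound, `|s| ≥ T` the uniform
one together with the decay of the test function. -/
theorem norm_difference_le (hS : S.IsModularCFT) {β : ℝ} (hβ : 0 < β) {φ : ℝ → ℂ}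
    (hφ : ContDiff ℝ ∞ φ) (hs : HasCompactSupport φ) (Λ b : ℝ) (N : ℕ) :
    ∃ C K κ : ℝ, 0 < C ∧ 0 < K ∧ 0 < κ ∧ ∀ (J : ℤ) (lam hstar T : ℝ), SmallAlpha S.A β J →
      0 < lam → lam ≤ Λ → hstar ≤ b → 0 < T →
      ‖(∫ h in Ioi S.Tgap, rescale φ hstar lam h ∂(S.rhoH J)) -
          ∫ h in Ioi S.Tgap, rescale φ hstar lam h * rhoVac S.A β J h‖ ≤
        C * (lam ^ 2)⁻¹ * ((alphaJ S.A J)⁻¹ * vacScale S.A J) *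
          (Real.exp (-κ / alphaJ S.A J + K * (1 + T ^ 2)) + ((lam * T) ^ N)⁻¹) := by
  have hA := hS.A_pos
  obtain ⟨C₁, K, κ, hC₁, hK, hκ, h₁⟩ := hS.norm_laplaceRemainder_le hβ
  obtain ⟨C₂, hC₂, h₂⟩ := hS.norm_laplaceRemainder_le_const hβ
  obtain ⟨D₁, hD₁, g₁⟩ := norm_testTransform_rescale_le hφ hs S.A hβ Λ b 2
  -- Two of the `N + 2` powers keep the `s`-integral convergent; the other `N` produce `(λT)^{-N}`.
  obtain ⟨D₂, hD₂, g₂⟩ := norm_testTransform_rescale_le hφ hs S.A hβ Λ b (N + 2)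
  set I : ℝ := ∫ s : ℝ, (‖(β : ℂ) + (s : ℂ) * Complex.I‖ ^ 2)⁻¹ with hI
  have hI0 : 0 ≤ I := integral_nonneg fun s => by positivity
  refine ⟨(D₁ * C₁ + D₂ * C₂ + 1) * (I + 1), K, κ, by positivity, hK, hκ,
    fun J lam hstar T hJ hlam hΛ hb hT => ?_⟩
  have hα := hJ.alphaJ_pos hA
  have hv := hJ.vacScale_pos hA
  set V : ℝ := (alphaJ S.A J)⁻¹ * vacScale S.A J with hV
  have hV0 : 0 < V := by positivity
  set E : ℝ := Real.exp (-κ / alphaJ S.A J + K * (1 + T ^ 2)) with hE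
  have hE0 : 0 < E := Real.exp_pos _
  set P : ℝ := ((lam * T) ^ N)⁻¹ with hP
  have hP0 : 0 < P := by positivity
  rw [hS.difference_eq hβ hJ (continuous_rescale hφ.continuous _ _)
    (hasCompactSupport_rescale hs hstar hlam)
    (integrable_testTransform_rescale hφ hs S.A hβ hlam hstar), norm_mul]
  have hpt : ∀ s : ℝ, ‖testTransform S.A β (rescale φ hstar lam) s *
      S.laplaceRemainder J ((β : ℂ) + (s : ℂ) * Complex.I)‖ ≤
      ((D₁ * C₁ + D₂ * C₂) * (lam ^ 2)⁻¹ * V * (E + P)) *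
        (‖(β : ℂ) + (s : ℂ) * Complex.I‖ ^ 2)⁻¹ := by
    intro s
    set n : ℝ := ‖(β : ℂ) + (s : ℂ) * Complex.I‖ with hn
    have hn0 : 0 < n := norm_pos_iff.2 (Complex.ne_zero_of_re_pos (by simpa using hβ))
    rw [norm_mul]
    rcases le_total |s| T with hsT | hsT
    · have e1 : ‖S.laplaceRemainder J ((β : ℂ) + (s : ℂ) * Complex.I)‖ ≤ C₁ * V * E := by
        refine (h₁ J s hJ).trans ?_
        have h3 : s ^ 2 ≤ T ^ 2 := by
          rw [← sq_abs]
          gcongr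
        calc _ ≤ C₁ * V * Real.exp (-κ / alphaJ S.A J) * Real.exp (K * (1 + T ^ 2)) := by
              gcongr
          _ = _ := by
              rw [hE, Real.exp_add]
              ring
      calc _ ≤ D₁ * ((lam * n) ^ 2)⁻¹ * (C₁ * V * E) := by
            have := g₁ lam hstar s hlam hΛ hb
            gcongr
        _ = (D₁ * C₁) * (lam ^ 2)⁻¹ * V * E * (n ^ 2)⁻¹ := by
            rw [mul_pow, mul_inv]
            ring
        _ ≤ (D₁ * C₁ + D₂ * C₂) * (lam ^ 2)⁻¹ * V * (E + P) * (n ^ 2)⁻¹ := by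
            have : D₁ * C₁ ≤ D₁ * C₁ + D₂ * C₂ := le_add_of_nonneg_right (by positivity)
            have : E ≤ E + P := le_add_of_nonneg_right hP0.le
            gcongr
    · have hTn : T ≤ n := by
        refine hsT.trans ?_
        have := Complex.abs_im_le_norm ((β : ℂ) + (s : ℂ) * Complex.I)
        simpa using this
      have e2 : ((lam * n) ^ (N + 2))⁻¹ ≤ P * ((lam ^ 2)⁻¹ * (n ^ 2)⁻¹) := by
        rw [pow_add, mul_inv, mul_pow lam n 2, mul_inv (lam ^ 2), hP]
        gcongr
      calc _ ≤ D₂ * (P * ((lam ^ 2)⁻¹ * (n ^ 2)⁻¹)) * (C₂ * V) := by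
            have e3 := (g₂ lam hstar s hlam hΛ hb).trans (mul_le_mul_of_nonneg_left e2 hD₂)
            have e4 := h₂ J s hJ
            gcongr
        _ = (D₂ * C₂) * (lam ^ 2)⁻¹ * V * P * (n ^ 2)⁻¹ := by ring
        _ ≤ (D₁ * C₁ + D₂ * C₂) * (lam ^ 2)⁻¹ * V * (E + P) * (n ^ 2)⁻¹ := by
            have : D₂ * C₂ ≤ D₁ * C₁ + D₂ * C₂ := le_add_of_nonneg_left (by positivity)
            have : P ≤ E + P := le_add_of_nonneg_left hE0.le
            gcongr
  have hfin := norm_integral_le_of_norm_le ((integrable_inv_sq_norm_line hβ).const_mul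
    ((D₁ * C₁ + D₂ * C₂) * (lam ^ 2)⁻¹ * V * (E + P))) (Eventually.of_forall hpt)
  rw [integral_const_mul] at hfin
  have hhalf : ‖(1 / 2 : ℂ)‖ ≤ 1 := by norm_num
  calc _ ≤ 1 * ((D₁ * C₁ + D₂ * C₂) * (lam ^ 2)⁻¹ * V * (E + P) * I) := by gcongr
    _ = (D₁ * C₁ + D₂ * C₂) * I * (lam ^ 2)⁻¹ * V * (E + P) := by ring
    _ ≤ _ := by
        have e1 : D₁ * C₁ + D₂ * C₂ ≤ D₁ * C₁ + D₂ * C₂ + 1 := by linarith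
        have e2 : I ≤ I + 1 := by linarith
        gcongr

end CFTData.IsModularCFT

/-! ### Asymptotics in `J` and conclusion -/

theorem tendsto_pow_mul_exp_neg_sqrt {κ : ℝ} (hκ : 0 < κ) (n : ℕ) :
    Tendsto (fun x : ℝ => x ^ n * Real.exp (-κ * √x)) atTop (nhds 0) := by
  have h := (tendsto_rpow_mul_exp_neg_mul_atTop_nhds_zero (2 * n : ℝ) κ hκ).comp
    Real.tendsto_sqrt_atTop
  refine h.congr' ?_
  filter_upwards [eventually_ge_atTop 0] with x hx
  simp only [Function.comp_apply]
  congr 1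
  rw [show (2 * n : ℝ) = ((2 * n : ℕ) : ℝ) by push_cast; rfl, Real.rpow_natCast, pow_mul,
    Real.sq_sqrt hx]

/-- The squared cut is `x^{-ε}√x`, eventually absorbed by half of `κ√x`. -/
theorem tendsto_pow_mul_exp_neg_sqrt_add {κ K ε : ℝ} (hκ : 0 < κ) (hε : 0 < ε) (n : ℕ) :
    Tendsto (fun x : ℝ => x ^ n * Real.exp (-κ * √x + K * (1 + (x ^ (1 / 4 - ε / 2)) ^ 2)))
      atTop (nhds 0) := by
  have h1 := (tendsto_pow_mul_exp_neg_sqrt (half_pos hκ) n).const_mul (Real.exp K)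
  rw [mul_zero] at h1
  have h2 : ∀ᶠ x : ℝ in atTop, K * x ^ (-ε) ≤ κ / 2 := by
    have := (tendsto_rpow_neg_atTop hε).const_mul K
    rw [mul_zero] at this
    exact this.eventually_le_const (half_pos hκ)
  refine tendsto_of_tendsto_of_tendsto_of_le_of_le' tendsto_const_nhds h1 ?_ ?_
  · filter_upwards [eventually_ge_atTop 0] with x hx
    positivity
  · filter_upwards [eventually_gt_atTop 0, h2] with x hx hx2
    have e1 : (x ^ (1 / 4 - ε / 2)) ^ 2 = x ^ (-ε) * √x := by
      rw [Real.sqrt_eq_rpow, ← Real.rpow_add hx, ← Real.rpow_natCast, ← Real.rpow_mul hx.le]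
      congr 1
      push_cast
      ring
    have e2 : -κ * √x + K * (1 + x ^ (-ε) * √x) ≤ K + -(κ / 2) * √x := by
      have := mul_le_mul_of_nonneg_right hx2 (Real.sqrt_nonneg x)
      linarith
    rw [e1, mul_left_comm, ← Real.exp_add]
    gcongr

theorem tendsto_pow_mul_inv_pow_rpow {δ ε : ℝ} (hδ : 0 < δ) (n N : ℕ)
    (hN : (n : ℝ) + 1 ≤ ε / 2 * N) :
    Tendsto (fun x : ℝ => x ^ n * ((δ * x ^ (ε / 2)) ^ N)⁻¹) atTop (nhds 0) := by
  have h1 := tendsto_inv_atTop_zero.const_mul ((δ ^ N)⁻¹)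
  rw [mul_zero] at h1
  refine tendsto_of_tendsto_of_tendsto_of_le_of_le' tendsto_const_nhds h1 ?_ ?_
  · filter_upwards [eventually_ge_atTop 0] with x hx
    positivity
  · filter_upwards [eventually_ge_atTop 1] with x hx
    have hx0 : 0 < x := by linarith
    have e1 : x ^ n * x ≤ (x ^ (ε / 2)) ^ N := by
      rw [← pow_succ, ← Real.rpow_natCast, ← Real.rpow_natCast (x ^ (ε / 2)),
        ← Real.rpow_mul hx0.le]
      push_cast
      exact Real.rpow_le_rpow_of_exponent_le hx hN
    rw [mul_pow, mul_inv, mul_left_comm]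
    gcongr
    rw [← div_eq_mul_inv, div_le_iff₀ (by positivity), ← div_eq_inv_mul, le_div_iff₀ hx0]
    exact e1

theorem theorem1 (S : CFTData) (hS : S.IsModularCFT)
    (R : ℝ) (φ : ℝ → ℂ) (hφ : ContDiff ℝ ∞ φ) (hφR : tsupport φ ⊆ Icc (-R) R)
    (ε δ : ℝ) (hε : 0 < ε) (hδ : 0 < δ)
    (lam : ℤ → ℝ)
    (hlam : ∀ᶠ J : ℤ in atTop, δ / (J : ℝ) ^ (1 / 4 - ε) ≤ lam J)
    (hlam_bdd : ∃ Λ : ℝ, ∀ᶠ J : ℤ in atTop, lam J ≤ Λ)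
    (β : ℝ) (hβ : 0 < β) :
    -- all integrals in the formula converge absolutely for large `J`
    (∀ᶠ J : ℤ in atTop,
      (∀ h : ℝ, Integrable (rhoVacIntegrand S.A β J h)) ∧
      ∀ hstar : ℝ,
        IntegrableOn (rescale φ hstar (lam J)) (Ioi S.Tgap) (S.rhoH J) ∧
        IntegrableOn (fun h => rescale φ hstar (lam J) h * rhoVac S.A β J h) (Ioi S.Tgap)) ∧
    -- the error is `(2J)^{-1/2} e^{4π√(AJ)} o(J^{-p})`, uniformly for `hstar` in `[a, b]`
    ∀ (p : ℕ) (a b κ : ℝ), 0 < κ → ∀ᶠ J : ℤ in atTop, ∀ hstar ∈ Icc a b,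
      ‖(∫ h in Ioi S.Tgap, rescale φ hstar (lam J) h ∂(S.rhoH J)) -
          ∫ h in Ioi S.Tgap, rescale φ hstar (lam J) h * rhoVac S.A β J h‖ ≤
        1 / √(2 * J) * Real.exp (4 * π * √(S.A * J)) * (κ * ((J : ℝ) ^ p)⁻¹) := by
  have hA := hS.A_pos
  have hs : HasCompactSupport φ := isCompact_Icc.of_isClosed_subset (isClosed_tsupport φ) hφR
  obtain ⟨Λ, hΛ⟩ := hlam_bdd
  have hsmall := eventually_smallAlpha S.A hβ
  have hpos : ∀ᶠ J : ℤ in atTop, 0 < lam J := by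
    filter_upwards [hlam, eventually_gt_atTop 0] with J h1 h2
    have : (0 : ℝ) < J := by exact_mod_cast h2
    exact lt_of_lt_of_le (by positivity) h1
  refine ⟨?_, fun p a b κ hκ => ?_⟩
  · filter_upwards [hsmall, hpos] with J hJ hl
    refine ⟨hJ.integrable_rhoVacIntegrand hA hβ, fun hstar => ?_⟩
    have hc := continuous_rescale hφ.continuous hstar (lam J)
    have hcs := hasCompactSupport_rescale hs hstar hl
    constructor
    · have := hS.isFiniteMeasureOnCompacts_twist J
      have hi : Integrable (rescale φ hstar (lam J)) (S.twistMeasure J) :=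
        hc.integrable_of_hasCompactSupport hcs
      exact (hi.smul_measure_nnreal (c := 2⁻¹)).integrableOn
    · exact ((hc.mul (hJ.continuous_rhoVac hA hβ)).integrable_of_hasCompactSupport
        hcs.mul_right).integrableOn
  -- The three powers beyond `p` pay for crude losses of one `J` each: `λ^{-2}`, the two factors
  -- `α^{-1}`, and the prefactor `(2J)^{-1/2}`. The further `+ 1` makes the tail tend to zero.
  · obtain ⟨N, hN⟩ := exists_nat_ge (((p + 3 : ℕ) + 1 : ℝ) / (ε / 2))
    rw [div_le_iff₀' (half_pos hε)] at hN
    obtain ⟨C, K, κ₀, hC, hK, hκ₀, hbound⟩ := hS.norm_difference_le hβ hφ hs Λ b N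
    set κ₁ : ℝ := κ₀ / (2 * π * √S.A) with hκ₁
    have hκ₁0 : 0 < κ₁ := by positivity
    set D : ℝ := C * (δ ^ 2)⁻¹ * ((4 * π ^ 2 * S.A)⁻¹ * 2) with hD
    have hlim := (((tendsto_pow_mul_exp_neg_sqrt_add (K := K) hκ₁0 hε (p + 3)).add
      (tendsto_pow_mul_inv_pow_rpow hδ (p + 3) N hN)).const_mul D).comp
      (tendsto_intCast_atTop_atTop (R := ℝ))
    rw [add_zero, mul_zero] at hlim
    filter_upwards [hsmall, hpos, hlam, hΛ, hlim.eventually_le_const hκ]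
      with J hJ hl hlJ hΛJ hJlim hstar hh
    have hx : (0 : ℝ) < J := hJ.cast_pos
    have hx1 : (1 : ℝ) ≤ J := by
      have : (1 : ℤ) ≤ J := by linarith [hJ.1]
      exact_mod_cast this
    have hα := hJ.alphaJ_pos hA
    simp only [Function.comp_apply] at hJlim
    set x : ℝ := (J : ℝ) with hxdef
    -- The exponent lies halfway between `1/4 - ε`, needed for `λT` not to shrink, and `1/4`, where
    -- `T²` would compete with `√J`.
    set T : ℝ := x ^ (1 / 4 - ε / 2) with hT
    have hT0 : 0 < T := by positivity
    refine (hbound J (lam J) hstar T hJ hl hΛJ hh.2 hT0).trans ?_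
    have e1 : -κ₀ / alphaJ S.A J = -κ₁ * √x := by
      rw [alphaJ_eq (by linarith [hJ.1]), hκ₁]
      have : 0 < √S.A := Real.sqrt_pos.2 hA
      field_simp
      rw [hxdef]
    have e2 : δ * x ^ (ε / 2) ≤ lam J * T := by
      calc δ * x ^ (ε / 2) = δ / x ^ (1 / 4 - ε) * T := by
            rw [hT, div_mul_eq_mul_div, mul_div_assoc, ← Real.rpow_sub hx]
            congr 2
            ring
        _ ≤ _ := by gcongr
    have e3 : (lam J ^ 2)⁻¹ ≤ (δ ^ 2)⁻¹ * x := by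
      have h1 : δ ^ 2 ≤ lam J ^ 2 * x := by
        have h2 : δ ≤ lam J * x ^ (1 / 2 : ℝ) := by
          rw [div_le_iff₀ (by positivity)] at hlJ
          refine hlJ.trans ?_
          have : x ^ (1 / 4 - ε) ≤ x ^ (1 / 2 : ℝ) :=
            Real.rpow_le_rpow_of_exponent_le hx1 (by linarith)
          gcongr
        calc δ ^ 2 ≤ (lam J * x ^ (1 / 2 : ℝ)) ^ 2 := by gcongr
          _ = lam J ^ 2 * x := by
            rw [mul_pow, ← Real.sqrt_eq_rpow, Real.sq_sqrt hx.le]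
      rw [inv_mul_eq_div, le_div_iff₀ (by positivity), inv_mul_le_iff₀ (by positivity)]
      exact h1
    have e4 : (alphaJ S.A J)⁻¹ * vacScale S.A J =
        (4 * π ^ 2 * S.A)⁻¹ * x * Real.exp (4 * π * √(S.A * x)) := by
      unfold vacScale
      have h1 : (alphaJ S.A J)⁻¹ * (alphaJ S.A J)⁻¹ = (4 * π ^ 2 * S.A)⁻¹ * x := by
        rw [← mul_inv, alphaJ_eq (by linarith [hJ.1]), div_mul_div_comm,
          Real.mul_self_sqrt hx.le, inv_div, div_eq_inv_mul]
        congr 2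
        rw [mul_mul_mul_comm, Real.mul_self_sqrt hA.le]
        ring
      rw [← mul_assoc, h1]
    have e5 : 1 ≤ 2 * x * (1 / √(2 * x)) := by
      rw [mul_one_div, le_div_iff₀ (by positivity), one_mul]
      exact Real.sqrt_le_self_of_one_le (by linarith)
    set E : ℝ := Real.exp (4 * π * √(S.A * x)) with hE
    set Q : ℝ := Real.exp (-κ₁ * √x + K * (1 + T ^ 2)) + ((δ * x ^ (ε / 2)) ^ N)⁻¹ with hQ
    have hQ0 : 0 < Q := by positivity
    have hJlim' : D * (x ^ (p + 3) * Q) ≤ κ := by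
      rw [hQ, mul_add]
      exact hJlim
    rw [e1, e4]
    calc _ ≤ C * ((δ ^ 2)⁻¹ * x) * ((4 * π ^ 2 * S.A)⁻¹ * x * E) * Q := by
          rw [hQ]
          gcongr
      _ = C * ((δ ^ 2)⁻¹ * x) * ((4 * π ^ 2 * S.A)⁻¹ * x * E) * Q * 1 := by ring
      _ ≤ C * ((δ ^ 2)⁻¹ * x) * ((4 * π ^ 2 * S.A)⁻¹ * x * E) * Q *
          (2 * x * (1 / √(2 * x))) := by gcongr
      _ = 1 / √(2 * x) * E * (D * (x ^ (p + 3) * Q) * (x ^ p)⁻¹) := by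
          rw [hD, pow_add]
          field_simp
      _ ≤ _ := by gcongr
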